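/- **Setting.** A bidder with budget $B>0$ takes part in $T=E\tau$ second-price auctions (rounds), divided into $E\ge1$ consecutive episodes of $\tau\ge 1$ rounds. In each round $t$ of episode $e$ the pair (value, highest competing bid) $(v_t,p_t)$ is drawn, independently of all other rounds, from $Q_e=F_e\times D_e$, where $F_e$ is supported on $[0,h]$ and $D_e$ on $[0,\infty)$. A strategy $\sigma$ with bids $b_t$ has utility $\pi^\sigma(v,p)=\sum_{t}\mathbf 1\{b_t>p_t\}(v_t-p_t)$. The hindsight benchmark is $\pi^H(v,p)=\max\{\sum_t(v_t-p_t)x_t : x\in[0,1]^T,\ \sum_t p_tx_t\le B\}$, and for $\alpha\in(0,1]$ the $\alpha$-regret of $\sigma$ is $\alpha\,\mathbb E[\pi^H]-\mathbb E[\pi^\sigma]$. **Duals and optimal spend rates.** Let $(z)^+=\max\{z,0\}$, $\Psi(\mu)=\mathbb E\big[\sum_{t=1}^T(v_t-(1+\mu)p_t)^+\big]+\mu B$, $G_e(\mu)=\mathbb E_{Q_e}[\mathbf 1\{v\ge(1+\mu)p\}\,p]$, and $\Psi_e(\mu,B_e)=\mathbb E_{Q_e}[\tau(v-(1+\mu)p)^+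 +\mu B_e]$. Rates $\rho_1,\dots,\rho_E$ are optimal spend rates if $\rho_e=G_e(\mu^\star)$ for all $e$, for some minimizer $\mu^\star\ge0$ of $\Psi$ on $[0,\infty)$. **Admissibility** (with constants $\lambda>0$, $M$, $\bar\mu$). For every $e$ and every $B_e\in\mathbb R$, the function $\Psi_e(\cdot,B_e)$ is thrice differentiable at every $\mu\ge0$, its derivatives of orders $1,2,3$ are bounded there in absolute value by $\tau M+|B_e|$, and it is $\tau\lambda$-strongly convex on $[0,\bar\mu]$. Moreover each $D_e$ is either a point mass or has a density on $[0,\infty)$ that is Lipschitz and bounded. **EpisodicAdaptivePacing** with inputs $B$, $\tau$, $E$, spend plan $(\rho'_1,\dots,\rho'_E)$, step size $\eta$ and maximal shading $\bar\mu$. Start with any $\mu_1\in[0,\bar\mu]$, campaign budget $\mathrm{Bud}=B$ and episode budget $\hat B=\rho'_1\tau$. In round $t$ of episode $e=\lceil t/\tau\rceil$, bid $b_t=\min\{v_t/(1+\mu_t),\hat B,\mathrm{Bud}\}$, pay $z_t=\mathbf 1\{b_t\ge p_t\}p_t$, set $\mu_{t+1}=\min\{\bar\mu,\max\{0,\mu_t-\eta(\rho'_e-z_t)\}\}$,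 and subtract $z_t$ from $\hat B$ and from $\mathrm{Bud}$. At the end of episode $e<E$, add $\rho'_{e+1}\tau$ to $\hat B$. **Statement.** For all $h,\lambda,\delta,c_1>0$ and all $M,\bar\mu,c_2$ there are constants $C$ and $k$, depending only on $h,\lambda,M,\bar\mu,\delta,c_1,c_2$, such that the following holds for all $E$, $\tau$, $B$ and all distributions as above that are admissible with constants $\lambda,M,\bar\mu$. Let $\rho_1,\dots,\rho_E$ be optimal spend rates, let $\omega\in[0,1)$, and let the plan satisfy $\rho_e\ge\rho'_e\ge(1-\omega)\rho_e$ for all $e$. Suppose that for each $e$ some minimizer of $\Psi_e(\cdot,\tau\rho'_e)$ over $[0,\infty)$ lies in $[0,\bar\mu-\delta]$, and that $c_1\tau^{-1/2}\le\eta\le c_2\tau^{-1/2}$. Then the strategy $\mathcal A$ given by EpisodicAdaptivePacing has $$(1-\omega)\,\mathbb E[\pi^H]-\mathbb E[\pi^{\mathcal A}]\ \le\ C\sqrt{ET}\,\big(1+\log(ET)\big)^k,$$ that is, its $(1-\omega)$-regret is $\tilde O(\sqrt{ET})$. -/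

import Mathlib

open MeasureTheory Set

noncomputable section

namespace EpisodicPacing

/-- A realized campaign of `T` rounds: round `t` has value `(x t).1` and highest competing
bid (price) `(x t).2`. -/
abbrev Outcome (T : ℕ) := Fin T → ℝ × ℝ

/-! ### The episodic setting -/

/-- Values in every episode are supported on `[0, h]` and prices on `[0, ∞)`. -/
structure IsEpisodicSetting {E : ℕ} (h : ℝ) (F D : Fin E → Measure ℝ) : Prop where
  value_prob : ∀ e, IsProbabilityMeasure (F e)
  price_prob : ∀ e, IsProbabilityMeasure (D e)
  value_mem : ∀ e, ∀ᵐ v ∂(F e), v ∈ Icc 0 h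
  price_nonneg : ∀ e, ∀ᵐ p ∂(D e), 0 ≤ p

/-- Law of the whole campaign of `T = E * τ` rounds: the rounds are independent, and the
pair `(v_t, p_t)` of a round `t` of episode `e` has law `Q_e = F_e × D_e`. Rounds and episodes
are numbered from `0`, so round `t` is in episode `t / τ`, which is `t.divNat`. -/
def campaignLaw {E : ℕ} (τ : ℕ) (F D : Fin E → Measure ℝ) : Measure (Outcome (E * τ)) :=
  Measure.pi fun t => (F t.divNat).prod (D t.divNat)

/-- Total utility of the bids `b`. -/
def performance {T : ℕ} (b : Fin T → ℝ) (x : Outcome T) : ℝ :=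
  ∑ t, if (x t).2 < b t then (x t).1 - (x t).2 else 0

/-- Utility of the best fractional allocation in hindsight with total expenditure at most `B`. -/
def hindsight {T : ℕ} (B : ℝ) (x : Outcome T) : ℝ :=
  sSup ((fun y : Fin T → ℝ => ∑ t, ((x t).1 - (x t).2) * y t) ''
    {y | (∀ t, y t ∈ Icc (0 : ℝ) 1) ∧ ∑ t, (x t).2 * y t ≤ B})

/-- The `α`-regret of a strategy, given as the map from outcomes to the bids that it makes. -/
def alphaRegret {E : ℕ} (τ : ℕ) (F D : Fin E → Measure ℝ) (B α : ℝ)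
    (σ : Outcome (E * τ) → Fin (E * τ) → ℝ) : ℝ :=
  α * (∫ x, hindsight B x ∂(campaignLaw τ F D))
    - ∫ x, performance (σ x) x ∂(campaignLaw τ F D)

/-! ### Spend functions, duals and optimal spend rates -/

/-- Expected expenditure `G_e(μ)` in one round with value law `F` and price law `D` when
bidding `v / (1 + μ)` with no budget constraint. -/
def spend (F D : Measure ℝ) (μ : ℝ) : ℝ :=
  ∫ x : ℝ × ℝ, (if (1 + μ) * x.2 ≤ x.1 then x.2 else 0) ∂(F.prod D)

/-- The dual function of an episode of `τ` rounds with budget `Be`. -/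
def episodeDual (τ : ℕ) (F D : Measure ℝ) (Be μ : ℝ) : ℝ :=
  ∫ x : ℝ × ℝ, (τ * max (x.1 - (1 + μ) * x.2) 0 + μ * Be) ∂(F.prod D)

/-- The dual function `Ψ` of the whole campaign. -/
def campaignDual {E : ℕ} (τ : ℕ) (F D : Fin E → Measure ℝ) (B μ : ℝ) : ℝ :=
  ∫ x, ((∑ t, max ((x t).1 - (1 + μ) * (x t).2) 0) + μ * B) ∂(campaignLaw τ F D)

/-- `ρ` are optimal spend rates: `ρ_e = G_e(μ⋆)` for a minimizer `μ⋆ ≥ 0` of `Ψ`. -/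
def IsOptimalSpendRates {E : ℕ} (τ : ℕ) (F D : Fin E → Measure ℝ) (B : ℝ)
    (ρ : Fin E → ℝ) : Prop :=
  ∃ μs : ℝ, 0 ≤ μs ∧ IsMinOn (campaignDual τ F D B) (Ici 0) μs ∧
    ∀ e, ρ e = spend (F e) (D e) μs

/-- The price is deterministic, or has a Lipschitz and bounded density on `[0, ∞)`. -/
def RegularPrice (D : Measure ℝ) : Prop :=
  (∃ c : ℝ, D = Measure.dirac c) ∨
  ∃ (d : ℝ → ℝ) (K : NNReal) (b : ℝ), LipschitzOnWith K d (Ici 0) ∧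
    (∀ p, 0 ≤ p → 0 ≤ d p ∧ d p ≤ b) ∧
    D = (volume.restrict (Ici 0)).withDensity fun p => ENNReal.ofReal (d p)

/-- Admissible distributions, with quantitative constants. For every episode and every episode
budget `Be` the dual is thrice differentiable at every `μ ≥ 0`, its first three derivatives
are bounded there, and it is strongly convex on the range `[0, mubar]` of the multipliers.
(Strong convexity on all of `[0, ∞)` is impossible: up to the linear term `μ * Be` the dual is
convex, nonnegative and nonincreasing there.) As the dual is `τ` times a per-round function plus
`μ * Be`, the constants `lam` and `M` are per round. -/
structure Admissible {E : ℕ} (τ : ℕ) (F D : Fin E → Measure ℝ) (lam M mubar : ℝ) : Prop where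
  differentiable : ∀ e Be, ∀ k < 3, ∀ μ, 0 ≤ μ →
    DifferentiableAt ℝ (iteratedDeriv k (episodeDual τ (F e) (D e) Be)) μ
  bounded : ∀ e Be, ∀ k ∈ Icc 1 3, ∀ μ, 0 ≤ μ →
    |iteratedDeriv k (episodeDual τ (F e) (D e) Be) μ| ≤ τ * M + |Be|
  strongConvex : ∀ e Be,
    StrongConvexOn (Icc 0 mubar) (τ * lam) (episodeDual τ (F e) (D e) Be)
  price : ∀ e, RegularPrice (D e)

/-! ### The algorithm -/

/-- State of the algorithm before a round: the multiplier `μ_t`, the remaining budget of the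
current episode and the remaining budget of the campaign. -/
structure PacingState where
  mult : ℝ
  episodeBudget : ℝ
  budget : ℝ

/-- The bid made in a state on observing the value `v`. -/
def PacingState.bid (s : PacingState) (v : ℝ) : ℝ :=
  min (min (v / (1 + s.mult)) s.episodeBudget) s.budget

/-- The expenditure in a state when the value is `v` and the price is `p`. -/
def PacingState.expenditure (s : PacingState) (v p : ℝ) : ℝ :=
  if p ≤ s.bid v then p else 0

/-- The spend plan as a function of all natural numbers, zero after the last episode. -/
def planRate {E : ℕ} (ρ' : Fin E → ℝ) (e : ℕ) : ℝ :=
  if he : e < E then ρ' ⟨e, he⟩ else 0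

/-- One round of the algorithm: `t` is the number of the round, from `0`. The multiplier moves
by a projected gradient step; after the last round of an episode the episode budget is
replenished, and what was left over is carried forward. -/
def PacingState.next {E : ℕ} (τ : ℕ) (ρ' : Fin E → ℝ) (η mubar : ℝ) (t : ℕ) (v p : ℝ)
    (s : PacingState) : PacingState where
  mult := max 0 (min mubar (s.mult - η * (planRate ρ' (t / τ) - s.expenditure v p)))
  episodeBudget := s.episodeBudget - s.expenditure v p +
    if (t + 1) % τ = 0 then planRate ρ' ((t + 1) / τ) * τ else 0
  budget := s.budget - s.expenditure v p

/-- State of the algorithm after the first `t` rounds, from the initial multiplier `μ₁`. -/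
def pacingState {E : ℕ} (τ : ℕ) (B : ℝ) (ρ' : Fin E → ℝ) (η mubar μ₁ : ℝ)
    (x : Outcome (E * τ)) : ℕ → PacingState
  | 0 => ⟨μ₁, planRate ρ' 0 * τ, B⟩
  | t + 1 =>
    if ht : t < E * τ then
      (pacingState τ B ρ' η mubar μ₁ x t).next τ ρ' η mubar t (x ⟨t, ht⟩).1 (x ⟨t, ht⟩).2
    else pacingState τ B ρ' η mubar μ₁ x t

/-- The strategy of episodic adaptive pacing: its bids on each outcome. -/
def episodicAdaptivePacing {E : ℕ} (τ : ℕ) (B : ℝ) (ρ' : Fin E → ℝ) (η mubar μ₁ : ℝ)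
    (x : Outcome (E * τ)) (t : Fin (E * τ)) : ℝ :=
  (pacingState τ B ρ' η mubar μ₁ x t).bid (x t).1

end EpisodicPacing

end

/-! Everything is compared with the episode duals. Write `R_e` for the per-round dual `roundDual`;
it is convex and its derivative is minus the spend `G_e`. Weak duality bounds the benchmark by
`Ψ(μ⋆)`, and complementary slackness turns this into the sum of `τ (R_e(μ⋆) + μ⋆ ρ_e)`. Convexity
moves the multiplier from `μ⋆` to the minimizer `u` of the episode dual. Since `ρ'_e ≥ (1 - ω) ρ_e`
and `R_e ≥ 0`, the factor `1 - ω` leaves at most the sum of `τ V_e`, with `V_e = R_e(u) + u ρ'_e`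
(`mul_integral_hindsight_le`).

It remains to lose only `O(√τ)` against `τ V_e` in each episode (`episode_loss`). As long as the
episode budget is at least `h` it truncates no bid, and then expected utility plus `μ_t (ρ'_e -
z_t)` equals `R_e(μ_t) + μ_t ρ'_e ≥ V_e`. The regret of projected gradient descent against the point
`0` bounds the total of `μ_t (ρ'_e - z_t)` by `O(√τ)` (`sum_solvent_mul_le`).

The other rounds cost at most `h` each, so their number must be `O(√τ)`. The update of the
multiplier records the spending: up to overshoot beyond the cap, spending ahead of plan raises the
multiplier, which is bounded, so the budget can run low early only by `O(1/η)` plus total overshoot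
over `η` (`mul_sum_insolvent_le`). Overshoot needs `μ_t` far from `u`, so it is dominated by `(μ_t -
u)²` (`overshoot_le`). Strong monotonicity of `G_e` and gradient descent regret against `u` bound
the expected sum of these squares. Strong convexity also gives `ρ'_e ≥ λ δ`, which converts planned
spend into a number of rounds. Adding up, `E √τ = √(E T)`. -/

namespace EpisodicPacing

/-! ### One round -/

/-- The dual function of a single round without its budget term. -/
noncomputable def roundDual (F D : Measure ℝ) (μ : ℝ) : ℝ :=
  ∫ x : ℝ × ℝ, max (x.1 - (1 + μ) * x.2) 0 ∂(F.prod D)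

/-- Expenditure of the bid `v / (1 + μ)` when a tie is won. -/
noncomputable def pay (μ : ℝ) (x : ℝ × ℝ) : ℝ := if (1 + μ) * x.2 ≤ x.1 then x.2 else 0

/-- Utility of the bid `v / (1 + μ)` when a tie is lost. -/
noncomputable def gain (μ : ℝ) (x : ℝ × ℝ) : ℝ := if (1 + μ) * x.2 < x.1 then x.1 - x.2 else 0

/-- A round whose value lies in `[0, h]` and whose price is nonnegative. -/
def IsRound (h : ℝ) (x : ℝ × ℝ) : Prop := x.1 ∈ Icc 0 h ∧ 0 ≤ x.2

theorem ae_isRound {h : ℝ} {F D : Measure ℝ} [IsProbabilityMeasure F] [IsProbabilityMeasure D]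
    (hF : ∀ᵐ v ∂F, v ∈ Icc 0 h) (hD : ∀ᵐ p ∂D, 0 ≤ p) :
    ∀ᵐ x ∂(F.prod D), IsRound h x := by
  filter_upwards [Measure.quasiMeasurePreserving_fst.ae hF,
    Measure.quasiMeasurePreserving_snd.ae hD] with x h1 h2 using ⟨h1, h2⟩

theorem IsRound.pay_mem {h : ℝ} {x : ℝ × ℝ} (hx : IsRound h x) {μ : ℝ} (hμ : 0 ≤ μ) :
    pay μ x ∈ Icc 0 h := by
  obtain ⟨⟨h1, h2⟩, h3⟩ := hx
  unfold pay
  split_ifs with hc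
  · exact ⟨h3, by nlinarith⟩
  · exact ⟨le_rfl, h1.trans h2⟩

theorem IsRound.gain_mem {h : ℝ} {x : ℝ × ℝ} (hx : IsRound h x) {μ : ℝ} (hμ : 0 ≤ μ) :
    gain μ x ∈ Icc 0 h := by
  obtain ⟨⟨h1, h2⟩, h3⟩ := hx
  unfold gain
  split_ifs with hc
  · exact ⟨by nlinarith, by linarith⟩
  · exact ⟨le_rfl, h1.trans h2⟩

/-- The range `-1 < μ`, instead of `0 ≤ μ`, allows two-sided derivatives of the dual at `μ = 0`. -/
theorem IsRound.surplus_mem {h : ℝ} {x : ℝ × ℝ} (hx : IsRound h x) {μ : ℝ} (hμ : -1 < μ) :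
    max (x.1 - (1 + μ) * x.2) 0 ∈ Icc 0 h := by
  obtain ⟨⟨h1, h2⟩, h3⟩ := hx
  refine ⟨le_max_right _ _, max_le ?_ (h1.trans h2)⟩
  have : 0 ≤ (1 + μ) * x.2 := mul_nonneg (by linarith) h3
  linarith

theorem surplus_sub_pay_le (μ ν : ℝ) (x : ℝ × ℝ) :
    max (x.1 - (1 + μ) * x.2) 0 - pay μ x * (ν - μ) ≤ max (x.1 - (1 + ν) * x.2) 0 := by
  unfold pay
  split_ifs with hc
  · rw [max_eq_left (by linarith)]
    exact le_max_of_le_left (by linarith)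
  · rw [max_eq_right (by linarith)]
    exact le_max_of_le_right (by linarith)

theorem integrable_of_ae_mem_Icc {α : Type*} [MeasurableSpace α] {P : Measure α}
    [IsFiniteMeasure P] {f : α → ℝ} (hf : Measurable f) {a b : ℝ}
    (hb : ∀ᵐ x ∂P, f x ∈ Icc a b) : Integrable f P :=
  Integrable.of_mem_Icc a b hf.aemeasurable hb

theorem measurable_pay (μ : ℝ) : Measurable (pay μ) :=
  Measurable.ite (measurableSet_le (by fun_prop) (by fun_prop)) (by fun_prop) (by fun_prop)

theorem measurable_gain (μ : ℝ) : Measurable (gain μ) :=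
  Measurable.ite (measurableSet_lt (by fun_prop) (by fun_prop)) (by fun_prop) (by fun_prop)

/-! ### Spend and utility through the derivative of the dual. -/

section Round

variable {h : ℝ} {F D : Measure ℝ} [IsProbabilityMeasure F] [IsProbabilityMeasure D]
  (hF : ∀ᵐ v ∂F, v ∈ Icc 0 h) (hD : ∀ᵐ p ∂D, 0 ≤ p)

include hF hD

theorem integrable_pay {μ : ℝ} (hμ : 0 ≤ μ) : Integrable (pay μ) (F.prod D) :=
  integrable_of_ae_mem_Icc (measurable_pay μ)
    ((ae_isRound hF hD).mono fun _ hx => hx.pay_mem hμ)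

theorem integrable_gain {μ : ℝ} (hμ : 0 ≤ μ) : Integrable (gain μ) (F.prod D) :=
  integrable_of_ae_mem_Icc (measurable_gain μ)
    ((ae_isRound hF hD).mono fun _ hx => hx.gain_mem hμ)

theorem integrable_surplus {μ : ℝ} (hμ : -1 < μ) :
    Integrable (fun x : ℝ × ℝ => max (x.1 - (1 + μ) * x.2) 0) (F.prod D) :=
  integrable_of_ae_mem_Icc (by fun_prop)
    ((ae_isRound hF hD).mono fun _ hx => hx.surplus_mem hμ)

theorem spend_mem {μ : ℝ} (hμ : 0 ≤ μ) : spend F D μ ∈ Icc 0 h := by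
  have hb := (ae_isRound hF hD).mono fun _ hx => hx.pay_mem hμ
  constructor
  · exact integral_nonneg_of_ae (hb.mono fun _ hx => hx.1)
  · have := integral_mono_ae (integrable_pay hF hD hμ) (integrable_const h)
      (hb.mono fun _ hx => hx.2)
    simpa [spend, pay] using this

theorem roundDual_mem {μ : ℝ} (hμ : -1 < μ) : roundDual F D μ ∈ Icc 0 h := by
  have hb := (ae_isRound hF hD).mono fun _ hx => hx.surplus_mem hμ
  constructor
  · exact integral_nonneg_of_ae (hb.mono fun _ hx => hx.1)
  · have := integral_mono_ae (integrable_surplus hF hD hμ) (integrable_const h)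
      (hb.mono fun _ hx => hx.2)
    simpa [roundDual] using this

theorem episodeDual_eq (τ : ℕ) (Be : ℝ) {μ : ℝ} (hμ : -1 < μ) :
    episodeDual τ F D Be μ = τ * roundDual F D μ + μ * Be := by
  unfold episodeDual roundDual
  rw [integral_add ((integrable_surplus hF hD hμ).const_mul _) (integrable_const _),
    integral_const_mul]
  simp

/-- The payment of any rule that wins when `(1 + μ) p < v` and loses when `v < (1 + μ) p` is,
up to sign, a subgradient of the dual; hence it is minus its derivative. -/
theorem hasDerivAt_roundDual_of_subgradient {μ : ℝ} (hμ : 0 ≤ μ) {g : ℝ × ℝ → ℝ}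
    (hg : Integrable g (F.prod D))
    (hsub : ∀ x : ℝ × ℝ, ∀ ν : ℝ, max (x.1 - (1 + μ) * x.2) 0 - g x * (ν - μ) ≤
      max (x.1 - (1 + ν) * x.2) 0)
    (hd : DifferentiableAt ℝ (roundDual F D) μ) :
    HasDerivAt (roundDual F D) (-∫ x, g x ∂(F.prod D)) μ := by
  set c := ∫ x, g x ∂(F.prod D)
  -- Integrating the pointwise subgradient inequality makes `μ` a local minimum once the linear term
  -- is added; Fermat's rule then identifies the derivative.
  have hmin : IsLocalMin (fun ν => roundDual F D ν + c * (ν - μ)) μ := by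
    filter_upwards [lt_mem_nhds (show -1 < μ by linarith)] with ν hν
    have := integral_mono ((integrable_surplus hF hD (show -1 < μ by linarith)).sub
      (hg.mul_const (ν - μ))) (integrable_surplus hF hD hν) (fun x => hsub x ν)
    simp only [Pi.sub_apply] at this
    rw [integral_sub (integrable_surplus hF hD (by linarith)) (hg.mul_const _),
      integral_mul_const] at this
    simp only [sub_self, mul_zero, add_zero]
    change roundDual F D μ - c * (ν - μ) ≤ roundDual F D ν at this
    linarith
  have h1 : HasDerivAt (fun ν => roundDual F D ν + c * (ν - μ))
      (deriv (roundDual F D) μ + c * 1) μ :=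
    hd.hasDerivAt.add (((hasDerivAt_id μ).sub_const μ).const_mul c)
  have h2 := hmin.hasDerivAt_eq_zero h1
  have h3 : deriv (roundDual F D) μ = -c := by linarith
  rw [← h3]
  exact hd.hasDerivAt

theorem hasDerivAt_roundDual {μ : ℝ} (hμ : 0 ≤ μ)
    (hd : DifferentiableAt ℝ (roundDual F D) μ) :
    HasDerivAt (roundDual F D) (-spend F D μ) μ := by
  refine hasDerivAt_roundDual_of_subgradient (g := pay μ) hF hD hμ (integrable_pay hF hD hμ)
    (fun x ν => surplus_sub_pay_le μ ν x) hd

theorem roundDual_sub_le {μ ν : ℝ} (hμ : 0 ≤ μ) (hν : -1 < ν) :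
    roundDual F D μ - spend F D μ * (ν - μ) ≤ roundDual F D ν := by
  have hi := integrable_surplus hF hD (show -1 < μ by linarith)
  have hp := (integrable_pay hF hD hμ).mul_const (ν - μ)
  have := integral_mono (hi.sub hp) (integrable_surplus hF hD hν)
    (fun x => surplus_sub_pay_le μ ν x)
  simp only [Pi.sub_apply] at this
  rw [integral_sub hi hp, integral_mul_const] at this
  exact this

/-- Expected utility of the bid `v / (1 + μ)`; ties do not matter as the dual is smooth. -/
theorem integral_gain {μ : ℝ} (hμ : 0 ≤ μ) (hd : DifferentiableAt ℝ (roundDual F D) μ) :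
    ∫ x, gain μ x ∂(F.prod D) = roundDual F D μ + μ * spend F D μ := by
  -- Payment when ties are lost. It is a subgradient as well, so uniqueness of the derivative gives
  -- it the same mean as `pay`.
  let g : ℝ × ℝ → ℝ := fun x => if (1 + μ) * x.2 < x.1 then x.2 else 0
  have hgm : Measurable g :=
    Measurable.ite (measurableSet_lt (by fun_prop) (by fun_prop)) (by fun_prop) (by fun_prop)
  have hg : Integrable g (F.prod D) := by
    refine integrable_of_ae_mem_Icc hgm (a := 0) (b := h) ?_
    filter_upwards [ae_isRound hF hD] with x hx
    obtain ⟨⟨h1, h2⟩, h3⟩ := hx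
    simp only [g]
    split_ifs with hc
    · exact ⟨h3, by nlinarith⟩
    · exact ⟨le_rfl, h1.trans h2⟩
  have h1 := hasDerivAt_roundDual_of_subgradient hF hD hμ hg (by
    intro x ν
    simp only [g]
    split_ifs with hc
    · rw [max_eq_left (by linarith)]
      exact le_max_of_le_left (by linarith)
    · rw [max_eq_right (by linarith)]
      exact le_max_of_le_right (by linarith)) hd
  have h2 := h1.unique (hasDerivAt_roundDual hF hD hμ hd)
  have h3 : spend F D μ = ∫ x, g x ∂(F.prod D) := by linarith
  rw [h3, roundDual, ← integral_const_mul,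
    ← integral_add (integrable_surplus hF hD (by linarith)) (hg.const_mul _)]
  congr 1 with x
  simp only [g, gain]
  split_ifs with hc
  · rw [max_eq_left (by linarith)]; ring
  · rw [max_eq_right (by linarith)]; ring

theorem differentiableAt_roundDual {τ : ℕ} (hτ : 0 < τ) {μ : ℝ} (hμ : 0 ≤ μ)
    (hd : DifferentiableAt ℝ (episodeDual τ F D 0) μ) :
    DifferentiableAt ℝ (roundDual F D) μ := by
  have h1 : DifferentiableAt ℝ (fun ν => (τ : ℝ)⁻¹ * episodeDual τ F D 0 ν) μ := hd.const_mul _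
  refine h1.congr_of_eventuallyEq ?_
  filter_upwards [lt_mem_nhds (show -1 < μ by linarith)] with ν hν
  rw [episodeDual_eq hF hD τ 0 hν]
  field_simp
  ring

end Round

/-! ### First-order conditions in one variable. -/

/-- First-order optimality condition on the half-line. -/
theorem deriv_mul_sub_nonneg_of_isMinOn {f : ℝ → ℝ} {d a : ℝ} (ha : 0 ≤ a)
    (hf : HasDerivAt f d a) (hmin : IsMinOn f (Ici 0) a) {ν : ℝ} (hν : 0 ≤ ν) :
    0 ≤ d * (ν - a) := by
  have h1 := hmin.localize.hasFDerivWithinAt_nonneg (y := ν - a)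
    hf.hasDerivWithinAt.hasFDerivWithinAt
    (sub_mem_posTangentConeAt_of_segment_subset ((convex_Ici 0).segment_subset ha hν))
  simpa [mul_comm] using h1

/-- The gradient of a strongly convex function is strongly monotone. -/
theorem mul_sub_le_deriv_sub_of_strongConvexOn {f f' : ℝ → ℝ} {s : Set ℝ} {m : ℝ}
    (hf : StrongConvexOn s m f) (hd : ∀ x ∈ s, HasDerivAt f (f' x) x) {x y : ℝ}
    (hx : x ∈ s) (hy : y ∈ s) (hxy : x ≤ y) : m * (y - x) ≤ f' y - f' x := by
  rcases hxy.eq_or_lt with rfl | hlt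
  · simp
  have hc := strongConvexOn_iff_convex.1 hf
  have hd' : ∀ z ∈ s, HasDerivAt (fun w => f w - m / 2 * ‖w‖ ^ 2) (f' z - m * z) z := by
    intro z hz
    have h1 := (hd z hz).sub ((hasDerivAt_pow 2 z).const_mul (m / 2))
    have h2 : (fun w : ℝ => f w - m / 2 * ‖w‖ ^ 2) = fun w => f w - m / 2 * w ^ 2 := by
      funext w
      rw [Real.norm_eq_abs, sq_abs]
    rw [h2]
    exact h1.congr_deriv (by push_cast; ring)
  have h1 := hc.le_slope_of_hasDerivAt hx hy hlt (hd' x hx)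
  have h2 := hc.slope_le_of_hasDerivAt hx hy hlt (hd' y hy)
  linarith

/-! ### One episode, path by path -/

/-- Indicator that a remaining budget `b` cannot truncate a bid of at most `h`. -/
noncomputable def solvent (h b : ℝ) : ℝ := if h ≤ b then 1 else 0

theorem solvent_mem (h b : ℝ) : solvent h b ∈ Icc 0 1 := by
  unfold solvent; split_ifs <;> norm_num

theorem solvent_mono (h : ℝ) : Monotone (solvent h) := by
  intro a b hab
  unfold solvent
  split_ifs <;> linarith

/-- The amount by which the unprojected gradient step overshoots the cap `U`. -/
noncomputable def overshoot (U η r m z : ℝ) : ℝ := max (m - η * (r - z) - U) 0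

section Path

variable {U η r h : ℝ} {τ : ℕ} {m b z : ℕ → ℝ}

/-- Regret bound for projected gradient steps, run until the budget is nearly exhausted. -/
theorem sum_solvent_mul_le (hη : 0 < η) (hr : r ∈ Icc 0 h)
    (hm : ∀ j, j < τ → m (j + 1) = max 0 (min U (m j - η * (r - z j))))
    (hb : ∀ j, j < τ → b (j + 1) = b j - z j) (hz : ∀ j, j < τ → z j ∈ Icc 0 h)
    (hm0 : m 0 ∈ Icc 0 U) {u : ℝ} (hu : u ∈ Icc 0 U) :
    ∑ j ∈ Finset.range τ, solvent h (b j) * ((m j - u) * (r - z j)) ≤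
      (U ^ 2 + τ * (η * h) ^ 2) / (2 * η) := by
  have key : ∀ n, n ≤ τ →
      2 * η * ∑ j ∈ Finset.range n, solvent h (b j) * ((m j - u) * (r - z j)) +
        solvent h (b n) * (m n - u) ^ 2 ≤ U ^ 2 + n * (η * h) ^ 2 := by
    intro n
    induction n with
    | zero =>
      intro _
      have h1 := solvent_mem h (b 0)
      have h2 : (m 0 - u) ^ 2 ≤ U ^ 2 := by
        apply sq_le_sq'
        · linarith [hm0.1, hu.2]
        · linarith [hm0.2, hu.1]
      have h3 : solvent h (b 0) * (m 0 - u) ^ 2 ≤ 1 * (m 0 - u) ^ 2 :=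
        mul_le_mul_of_nonneg_right h1.2 (sq_nonneg _)
      simp
      linarith
    | succ n ih =>
      intro hn
      have ih := ih (by omega)
      have hzn := hz n (by omega)
      have hstep : (m (n + 1) - u) ^ 2 ≤ (m n - η * (r - z n) - u) ^ 2 := by
        rw [hm n (by omega)]
        apply sq_le_sq.2
        rcases le_total U (m n - η * (r - z n)) with hc | hc
        · have hU : 0 ≤ U := hu.1.trans hu.2
          rw [min_eq_left hc, max_eq_right hU, abs_of_nonneg (by linarith [hu.2]),
            abs_of_nonneg (by linarith [hu.2])]
          linarith
        · rw [min_eq_right hc]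
          rcases le_total 0 (m n - η * (r - z n)) with hd | hd
          · rw [max_eq_right hd]
          · rw [max_eq_left hd, abs_of_nonpos (by linarith [hu.1]),
              abs_of_nonpos (by linarith [hu.1])]
            linarith
      have hgrad : (η * (r - z n)) ^ 2 ≤ (η * h) ^ 2 := by
        rw [mul_pow, mul_pow]
        refine mul_le_mul_of_nonneg_left ?_ (sq_nonneg _)
        apply sq_le_sq' <;> linarith [hzn.1, hzn.2, hr.1, hr.2]
      have hexp : (m (n + 1) - u) ^ 2 ≤
          (m n - u) ^ 2 - 2 * η * ((m n - u) * (r - z n)) + (η * h) ^ 2 := by nlinarith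
      have hle : solvent h (b (n + 1)) ≤ solvent h (b n) :=
        solvent_mono h (by rw [hb n (by omega)]; linarith [hzn.1])
      have h1 : solvent h (b (n + 1)) * (m (n + 1) - u) ^ 2 ≤
          solvent h (b n) * (m (n + 1) - u) ^ 2 :=
        mul_le_mul_of_nonneg_right hle (sq_nonneg _)
      have h2 := mul_le_mul_of_nonneg_left hexp (solvent_mem h (b n)).1
      have h3 : solvent h (b n) * (η * h) ^ 2 ≤ 1 * (η * h) ^ 2 :=
        mul_le_mul_of_nonneg_right (solvent_mem h (b n)).2 (sq_nonneg _)
      rw [Finset.sum_range_succ]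
      push_cast
      linarith
  have := key τ le_rfl
  rw [le_div_iff₀ (by positivity)]
  have h1 : 0 ≤ solvent h (b τ) * (m τ - u) ^ 2 :=
    mul_nonneg (solvent_mem h _).1 (sq_nonneg _)
  linarith

/-- The number of rounds lost to a nearly exhausted budget is controlled by the range of the
multipliers and their total overshoot. -/
theorem mul_sum_insolvent_le (hη : 0 < η) (hr : 0 ≤ r) (hh : 0 ≤ h)
    (hm : ∀ j, j < τ → m (j + 1) = max 0 (min U (m j - η * (r - z j))))
    (hb : ∀ j, j < τ → b (j + 1) = b j - z j)
    (hm0 : m 0 ∈ Icc 0 U) (hb0 : r * τ ≤ b 0) :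
    r * ∑ j ∈ Finset.range τ, (1 - solvent h (b j)) ≤
      h + (U + ∑ j ∈ Finset.range τ, solvent h (b j) * overshoot U η r (m j) (z j)) / η := by
  have hU : 0 ≤ U := hm0.1.trans hm0.2
  have hmU : ∀ n, n ≤ τ → m n ≤ U := by
    intro n hn
    cases n with
    | zero => exact hm0.2
    | succ n => rw [hm n (by omega)]; exact max_le hU (min_le_left _ _)
  have hK0 : ∀ n, 0 ≤ solvent h (b n) * overshoot U η r (m n) (z n) := fun n =>
    mul_nonneg (solvent_mem h _).1 (le_max_right _ _)
  set K : ℕ → ℝ := fun n =>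
    ∑ j ∈ Finset.range n, solvent h (b j) * overshoot U η r (m j) (z j) with hK
  set N : ℕ → ℝ := fun n => ∑ j ∈ Finset.range n, (1 - solvent h (b j)) with hN
  have hKs : ∀ n, K (n + 1) = K n + solvent h (b n) * overshoot U η r (m n) (z n) := fun n =>
    Finset.sum_range_succ _ _
  have hNs : ∀ n, N (n + 1) = N n + (1 - solvent h (b n)) := fun n => Finset.sum_range_succ _ _
  -- The left case is the phase before the budget falls below `h`: the budget ahead is compared with
  -- the plan through the multiplier. The right case holds from then on; each further round lowers
  -- `τ - n` by one and raises `N` by at most one.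
  have key : ∀ n, n ≤ τ → (N n = 0 ∧ η * (r * (τ - n)) ≤ η * b n + (m n - m 0 + K n)) ∨
      η * (r * (τ - n) + r * N n) ≤ η * h + (U + K n) := by
    intro n
    induction n with
    | zero =>
      intro _
      left
      simp only [hN, hK, Finset.range_zero, Finset.sum_empty, Nat.cast_zero, sub_zero, sub_self,
        add_zero, true_and]
      exact mul_le_mul_of_nonneg_left hb0 hη.le
    | succ n ih =>
      intro hn
      rw [hKs, hNs]
      push_cast
      rcases ih (by omega) with ⟨h1, h2⟩ | h1
      · by_cases ha : h ≤ b n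
        · left
          have hs : solvent h (b n) = 1 := if_pos ha
          refine ⟨by rw [h1, hs]; ring, ?_⟩
          have h3 : m n - η * (r - z n) ≤ m (n + 1) + overshoot U η r (m n) (z n) := by
            rw [hm n (by omega)]
            unfold overshoot
            rcases le_total U (m n - η * (r - z n)) with hc | hc
            · rw [min_eq_left hc, max_eq_right hU]
              linarith [le_max_left (m n - η * (r - z n) - U) 0]
            · rw [min_eq_right hc]
              linarith [le_max_right (m n - η * (r - z n) - U) 0,
                le_max_right 0 (m n - η * (r - z n))]
          rw [hs, hb n (by omega)]
          nlinarith
        · right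
          have hs : solvent h (b n) = 0 := if_neg ha
          rw [h1, hs]
          have h3 : η * b n ≤ η * h := mul_le_mul_of_nonneg_left (not_le.1 ha).le hη.le
          have := hmU n (by omega)
          have := hm0.1
          nlinarith
      · right
        have h3 := hK0 n
        have h4 : η * (r * (1 - solvent h (b n))) ≤ η * (r * 1) := by
          have := (solvent_mem h (b n)).1
          gcongr
          linarith
        nlinarith
  have hfin : η * (r * N τ) ≤ η * h + (U + K τ) := by
    rcases key τ le_rfl with ⟨h1, _⟩ | h1
    · rw [h1]
      have : 0 ≤ K τ := Finset.sum_nonneg fun j _ => hK0 j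
      have : 0 ≤ η * h := mul_nonneg hη.le hh
      linarith
    · simpa using h1
  have : h + (U + K τ) / η = (η * h + (U + K τ)) / η := by field_simp
  rw [this, le_div_iff₀ hη]
  linarith

/-- An overshoot only happens far from a point that lies well below the cap. -/
theorem overshoot_le {δ u m z : ℝ} (hη : 0 ≤ η) (hδ : 0 < δ) (hr : 0 ≤ r) (hz : z ∈ Icc 0 h)
    (hm : m ≤ U) (hu : u ≤ U - δ) :
    overshoot U η r m z ≤ η * h * (2 / δ ^ 2 * ((m - u) ^ 2 + (η * h) ^ 2)) := by
  have hh : 0 ≤ η * h := mul_nonneg hη (hz.1.trans hz.2)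
  have h1 : η * z ≤ η * h := mul_le_mul_of_nonneg_left hz.2 hη
  have h2 : 0 ≤ η * r := mul_nonneg hη hr
  unfold overshoot
  refine max_le ?_ (by positivity)
  by_cases hc : m - η * (r - z) ≤ U
  · have : 0 ≤ η * h * (2 / δ ^ 2 * ((m - u) ^ 2 + (η * h) ^ 2)) := by positivity
    linarith
  · have h3 : δ ≤ (m - u) + η * h := by nlinarith
    have h4 : δ ^ 2 ≤ 2 * ((m - u) ^ 2 + (η * h) ^ 2) := by
      have : δ ^ 2 ≤ ((m - u) + η * h) ^ 2 := pow_le_pow_left₀ hδ.le h3 2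
      nlinarith [sq_nonneg ((m - u) - η * h)]
    have h5 : 1 ≤ 2 / δ ^ 2 * ((m - u) ^ 2 + (η * h) ^ 2) := by
      rw [div_mul_eq_mul_div, le_div_iff₀ (by positivity)]
      linarith
    nlinarith

end Path

/-! ### The states of the algorithm -/

section States

variable {E τ : ℕ} {B η U μ₁ h : ℝ} {ρ' : Fin E → ℝ}

theorem planRate_val (e : Fin E) : planRate ρ' e = ρ' e := by
  simp [planRate]

theorem planRate_nonneg (hρ : ∀ e, 0 ≤ ρ' e) (n : ℕ) : 0 ≤ planRate ρ' n := by
  unfold planRate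
  split_ifs
  exacts [hρ _, le_rfl]

theorem sum_planRate_le (hρ : ∀ e, 0 ≤ ρ' e) (n : ℕ) :
    ∑ i ∈ Finset.range n, planRate ρ' i ≤ ∑ e, ρ' e := by
  have h1 : ∑ e, ρ' e = ∑ i ∈ Finset.range E, planRate ρ' i := by
    rw [← Fin.sum_univ_eq_sum_range]
    exact Finset.sum_congr rfl fun e _ => (planRate_val e).symm
  rw [h1]
  rcases le_total n E with hn | hn
  · exact Finset.sum_le_sum_of_subset_of_nonneg (Finset.range_mono hn)
      fun i _ _ => planRate_nonneg hρ i
  · refine (Finset.sum_subset (Finset.range_mono hn) fun i _ hi => ?_).ge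
    rw [Finset.mem_range] at hi
    simp [planRate, hi]

theorem pacingState_succ (x : Outcome (E * τ)) (t : Fin (E * τ)) :
    pacingState τ B ρ' η U μ₁ x (t + 1) =
      (pacingState τ B ρ' η U μ₁ x t).next τ ρ' η U t (x t).1 (x t).2 := by
  rw [pacingState, dif_pos t.2]

/-- The algorithm is nonanticipating: the state before round `t` is independent of that round. This
is what lets resampling act as conditioning. -/
theorem pacingState_update (x : Outcome (E * τ)) (t : Fin (E * τ)) (y : ℝ × ℝ) {n : ℕ}
    (hn : n ≤ t) :
    pacingState τ B ρ' η U μ₁ (Function.update x t y) n = pacingState τ B ρ' η U μ₁ x n := by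
  induction n with
  | zero => rfl
  | succ n ih =>
    have hne : (⟨n, by omega⟩ : Fin (E * τ)) ≠ t := fun hc => by
      have := congrArg Fin.val hc
      simp at this
      omega
    rw [pacingState, pacingState, ih (by omega)]
    split_ifs with hlt
    · rw [Function.update_of_ne hne]
    · rfl

theorem measurable_expenditure {α : Type*} [MeasurableSpace α] {s : α → PacingState} {v p : α → ℝ}
    (h1 : Measurable fun a => (s a).mult) (h2 : Measurable fun a => (s a).episodeBudget)
    (h3 : Measurable fun a => (s a).budget) (hv : Measurable v) (hp : Measurable p) :
    Measurable fun a => (s a).expenditure (v a) (p a) := by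
  unfold PacingState.expenditure PacingState.bid
  exact Measurable.ite (measurableSet_le hp (by fun_prop)) hp measurable_const

theorem measurable_pacingState (n : ℕ) :
    (Measurable fun x : Outcome (E * τ) => (pacingState τ B ρ' η U μ₁ x n).mult) ∧
    (Measurable fun x : Outcome (E * τ) => (pacingState τ B ρ' η U μ₁ x n).episodeBudget) ∧
    (Measurable fun x : Outcome (E * τ) => (pacingState τ B ρ' η U μ₁ x n).budget) := by
  induction n with
  | zero => exact ⟨measurable_const, measurable_const, measurable_const⟩
  | succ n ih =>
    obtain ⟨h1, h2, h3⟩ := ih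
    by_cases hn : n < E * τ
    · have hz := measurable_expenditure h1 h2 h3
        (v := fun x : Outcome (E * τ) => (x ⟨n, hn⟩).1) (p := fun x => (x ⟨n, hn⟩).2)
        (by fun_prop) (by fun_prop)
      simp only [pacingState, dif_pos hn, PacingState.next]
      exact ⟨by fun_prop, by fun_prop, by fun_prop⟩
    · simpa only [pacingState, dif_neg hn] using ⟨h1, h2, h3⟩

theorem mult_mem (hμ₁ : μ₁ ∈ Icc 0 U) (x : Outcome (E * τ)) (n : ℕ) :
    (pacingState τ B ρ' η U μ₁ x n).mult ∈ Icc 0 U := by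
  induction n with
  | zero => exact hμ₁
  | succ n ih =>
    rw [pacingState]
    split_ifs
    · exact ⟨le_max_left _ _, max_le (hμ₁.1.trans hμ₁.2) (min_le_left _ _)⟩
    · exact ih

theorem expenditure_nonneg {s : PacingState} {v p : ℝ} (hp : 0 ≤ p) : 0 ≤ s.expenditure v p := by
  unfold PacingState.expenditure
  split_ifs
  exacts [hp, le_rfl]

theorem expenditure_le_episodeBudget {s : PacingState} {v p : ℝ} (hs : 0 ≤ s.episodeBudget) :
    s.expenditure v p ≤ s.episodeBudget := by
  unfold PacingState.expenditure PacingState.bid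
  split_ifs with hc
  · exact hc.trans ((min_le_left _ _).trans (min_le_right _ _))
  · exact hs

theorem bid_le {s : PacingState} {v : ℝ} (hs : 0 ≤ s.mult) (hv : 0 ≤ v) : s.bid v ≤ v :=
  ((min_le_left _ _).trans (min_le_left _ _)).trans (div_le_self hv (by linarith))

theorem expenditure_le {s : PacingState} {x : ℝ × ℝ} (hx : IsRound h x) (hs : 0 ≤ s.mult) :
    s.expenditure x.1 x.2 ≤ h := by
  unfold PacingState.expenditure
  split_ifs with hc
  · exact (hc.trans (bid_le hs hx.1.1)).trans hx.1.2
  · exact hx.1.1.trans hx.1.2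

/-- With enough budget left, the bid is the shaded value. -/
theorem bid_eq {s : PacingState} {v : ℝ} (hs : 0 ≤ s.mult) (hv : v ∈ Icc 0 h)
    (h1 : h ≤ s.episodeBudget) (h2 : s.episodeBudget ≤ s.budget) :
    s.bid v = v / (1 + s.mult) := by
  have h3 : v / (1 + s.mult) ≤ h := (div_le_self hv.1 (by linarith)).trans hv.2
  unfold PacingState.bid
  rw [min_eq_left (h3.trans h1), min_eq_left (h3.trans (h1.trans h2))]

theorem expenditure_eq {s : PacingState} {x : ℝ × ℝ} (hs : 0 ≤ s.mult) (hx : IsRound h x)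
    (h1 : h ≤ s.episodeBudget) (h2 : s.episodeBudget ≤ s.budget) :
    s.expenditure x.1 x.2 = pay s.mult x := by
  unfold PacingState.expenditure pay
  rw [bid_eq hs hx.1 h1 h2]
  simp only [le_div_iff₀ (show 0 < 1 + s.mult by linarith), mul_comm]

/-- When the episode budget may bind, utility is only bounded below by zero, which holds because
bids never exceed values. -/
theorem solvent_mul_gain_le {s : PacingState} {x : ℝ × ℝ} (hs : 0 ≤ s.mult) (hx : IsRound h x)
    (h2 : s.episodeBudget ≤ s.budget) :
    solvent h s.episodeBudget * gain s.mult x ≤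
      if x.2 < s.bid x.1 then x.1 - x.2 else 0 := by
  unfold solvent
  split_ifs with h1 h3 h3
  · rw [bid_eq hs hx.1 h1 h2, lt_div_iff₀ (by linarith), mul_comm] at h3
    simp [gain, h3]
  · rw [bid_eq hs hx.1 h1 h2, lt_div_iff₀ (by linarith), mul_comm] at h3
    simp [gain, h3]
  · have := bid_le hs hx.1.1
    linarith
  · simp

variable (hρ : ∀ e, 0 ≤ ρ' e) {x : Outcome (E * τ)} (hx : ∀ t, IsRound h (x t))

include hρ in
theorem episodeBudget_nonneg (n : ℕ) : 0 ≤ (pacingState τ B ρ' η U μ₁ x n).episodeBudget := by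
  induction n with
  | zero => exact mul_nonneg (planRate_nonneg hρ _) (Nat.cast_nonneg _)
  | succ n ih =>
    rw [pacingState]
    split_ifs
    · have h1 : 0 ≤ if (n + 1) % τ = 0 then planRate ρ' ((n + 1) / τ) * τ else 0 := by
        split_ifs
        exacts [mul_nonneg (planRate_nonneg hρ _) (Nat.cast_nonneg _), le_rfl]
      exact add_nonneg (sub_nonneg.2 (expenditure_le_episodeBudget ih)) h1
    · exact ih

include hρ in
theorem planRate_mul_le_episodeBudget {n : ℕ} (hn : n ≤ E * τ) (hmod : n % τ = 0) :
    planRate ρ' (n / τ) * τ ≤ (pacingState τ B ρ' η U μ₁ x n).episodeBudget := by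
  cases n with
  | zero => simp [pacingState]
  | succ n =>
    rw [pacingState, dif_pos (by omega)]
    simp only [PacingState.next, if_pos hmod]
    have := expenditure_le_episodeBudget (v := (x ⟨n, by omega⟩).1) (p := (x ⟨n, by omega⟩).2)
      (episodeBudget_nonneg (τ := τ) (B := B) (η := η) (U := U) (μ₁ := μ₁) hρ (x := x) n)
    linarith

/-- The two budgets differ by the money not yet released to an episode. This is nonnegative for a
plan that fits `B`, so the campaign budget never truncates a bid before the episode budget does. -/
theorem budget_eq {n : ℕ} (hn : n ≤ E * τ) :
    (pacingState τ B ρ' η U μ₁ x n).budget =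
      (pacingState τ B ρ' η U μ₁ x n).episodeBudget +
        (B - τ * ∑ i ∈ Finset.range (n / τ + 1), planRate ρ' i) := by
  induction n with
  | zero => simp [pacingState]; ring
  | succ n ih =>
    have ih := ih (by omega)
    rw [pacingState, dif_pos (by omega)]
    simp only [PacingState.next]
    rw [ih, Nat.succ_div]
    by_cases hd : τ ∣ n + 1
    · rw [if_pos hd, if_pos (Nat.mod_eq_zero_of_dvd hd), Finset.sum_range_succ _ (n / τ + 1)]
      ring
    · rw [if_neg hd, if_neg fun hc => hd (Nat.dvd_of_mod_eq_zero hc)]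
      simp only [add_zero]
      ring

include hρ in
theorem episodeBudget_le_budget (hB : τ * ∑ e, ρ' e ≤ B) {n : ℕ} (hn : n ≤ E * τ) :
    (pacingState τ B ρ' η U μ₁ x n).episodeBudget ≤ (pacingState τ B ρ' η U μ₁ x n).budget := by
  rw [budget_eq hn]
  have : (τ : ℝ) * ∑ i ∈ Finset.range (n / τ + 1), planRate ρ' i ≤ τ * ∑ e, ρ' e :=
    mul_le_mul_of_nonneg_left (sum_planRate_le hρ _) (Nat.cast_nonneg _)
  linarith

include hρ hx in
/-- Both path estimates for episode `e` of the algorithm. -/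
theorem episode_path (hτ : 0 < τ) (hη : 0 < η) (hμ₁ : μ₁ ∈ Icc 0 U) (hρh : ∀ e, ρ' e ≤ h)
    (hB : τ * ∑ e, ρ' e ≤ B) (e : Fin E) :
    (∀ u ∈ Icc 0 U, ∑ j : Fin τ,
      solvent h (pacingState τ B ρ' η U μ₁ x (finProdFinEquiv (e, j))).episodeBudget *
        (((pacingState τ B ρ' η U μ₁ x (finProdFinEquiv (e, j))).mult - u) *
          (ρ' e - pay (pacingState τ B ρ' η U μ₁ x (finProdFinEquiv (e, j))).mult
            (x (finProdFinEquiv (e, j))))) ≤ (U ^ 2 + τ * (η * h) ^ 2) / (2 * η)) ∧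
    ∀ δ, 0 < δ → ∀ u, u ≤ U - δ →
    ρ' e * ∑ j : Fin τ,
      (1 - solvent h (pacingState τ B ρ' η U μ₁ x (finProdFinEquiv (e, j))).episodeBudget) ≤
      h + (U + ∑ j : Fin τ,
        solvent h (pacingState τ B ρ' η U μ₁ x (finProdFinEquiv (e, j))).episodeBudget *
          (η * h * (2 / δ ^ 2 *
            (((pacingState τ B ρ' η U μ₁ x (finProdFinEquiv (e, j))).mult - u) ^ 2
              + (η * h) ^ 2)))) / η := by
  set S := pacingState τ B ρ' η U μ₁ x with hS
  have hh : 0 ≤ h := (hρ e).trans (hρh e)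
  have hlt : ∀ j, j < τ → j + τ * (e : ℕ) < E * τ := fun j hj => by
    have := (finProdFinEquiv (e, (⟨j, hj⟩ : Fin τ))).2
    simpa using this
  let X : ℕ → ℝ × ℝ := fun n => if hn : n < E * τ then x ⟨n, hn⟩ else 0
  have hX : ∀ t : Fin (E * τ), X t = x t := fun t => dif_pos t.2
  let m : ℕ → ℝ := fun j => (S (j + τ * e)).mult
  let z : ℕ → ℝ := fun j => (S (j + τ * e)).expenditure (X (j + τ * e)).1 (X (j + τ * e)).2
  -- This omits the replenishment after the last round, so that `b` obeys one recursion for all `j <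
  -- τ`. It agrees with the true episode budget before each round of the episode.
  let b : ℕ → ℝ := fun j => (S (τ * e)).episodeBudget - ∑ i ∈ Finset.range j, z i
  have hnext : ∀ j, j < τ → S (j + 1 + τ * e) =
      (S (j + τ * e)).next τ ρ' η U (j + τ * e) (X (j + τ * e)).1 (X (j + τ * e)).2 := by
    intro j hj
    have h1 := pacingState_succ (B := B) (ρ' := ρ') (η := η) (U := U) (μ₁ := μ₁) x
      ⟨j + τ * e, hlt j hj⟩
    rw [← hX] at h1
    rw [show j + 1 + τ * (e : ℕ) = j + τ * e + 1 by ring]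
    exact h1
  have hdiv : ∀ j, j < τ → (j + τ * (e : ℕ)) / τ = e := fun j hj => by
    rw [Nat.add_mul_div_left _ _ hτ, Nat.div_eq_of_lt hj, zero_add]
  have hm : ∀ j, j < τ → m (j + 1) = max 0 (min U (m j - η * (ρ' e - z j))) := by
    intro j hj
    simp only [m, z]
    rw [hnext j hj]
    simp only [PacingState.next]
    rw [hdiv j hj, planRate_val]
  have hmem : ∀ n, (S n).mult ∈ Icc 0 U := fun n => mult_mem hμ₁ x n
  have hb : ∀ j, j < τ → b (j + 1) = b j - z j := by
    intro j _
    simp only [b]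
    rw [Finset.sum_range_succ]
    ring
  have hbS : ∀ j, j < τ → b j = (S (j + τ * e)).episodeBudget := by
    intro j
    induction j with
    | zero => intro _; simp [b]
    | succ j ih =>
      intro hj
      rw [hb j (by omega), ih (by omega), hnext j (by omega)]
      have h1 : ¬ (j + τ * (e : ℕ) + 1) % τ = 0 := by
        rw [show j + τ * (e : ℕ) + 1 = j + 1 + τ * e by ring, Nat.add_mul_mod_self_left,
          Nat.mod_eq_of_lt hj]
        omega
      simp only [PacingState.next, if_neg h1, add_zero, z]
  have hXr : ∀ j, j < τ → IsRound h (X (j + τ * e)) := fun j hj => by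
    rw [hX ⟨_, hlt j hj⟩]; exact hx _
  have hz : ∀ j, j < τ → z j ∈ Icc 0 h := fun j hj =>
    ⟨expenditure_nonneg (hXr j hj).2, expenditure_le (hXr j hj) (hmem _).1⟩
  -- Under the weight `solvent` actual and unconstrained payments coincide; the latter depend on the
  -- state through the multiplier alone, so their conditional mean is `spend`.
  have hpay : ∀ j, j < τ → ∀ g : ℝ → ℝ, solvent h (b j) * g (z j) =
      solvent h (S (j + τ * e)).episodeBudget * g (pay (m j) (X (j + τ * e))) := by
    intro j hj g
    rw [hbS j hj]
    by_cases hc : h ≤ (S (j + τ * e)).episodeBudget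
    · simp only [z, m]
      rw [expenditure_eq (hmem _).1 (hXr j hj) hc (episodeBudget_le_budget hρ hB (hlt j hj).le)]
    · simp [solvent, hc]
  have hb0 : ρ' e * τ ≤ b 0 := by
    have h1 := planRate_mul_le_episodeBudget (B := B) (η := η) (U := U) (μ₁ := μ₁) (x := x) hρ
      (n := τ * e) (by simpa using (hlt 0 hτ).le) (by simp)
    rw [Nat.mul_div_cancel_left _ hτ, planRate_val] at h1
    simpa [b] using h1
  have hfin : ∀ (f : ℕ → ℝ × ℝ → ℝ), ∑ j : Fin τ,
      f (finProdFinEquiv (e, j)) (x (finProdFinEquiv (e, j))) =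
      ∑ j ∈ Finset.range τ, f (j + τ * e) (X (j + τ * e)) := by
    intro f
    rw [← Fin.sum_univ_eq_sum_range (fun j => f (j + τ * e) (X (j + τ * e)))]
    refine Finset.sum_congr rfl fun j _ => ?_
    rw [← hX]
    simp
  constructor
  · intro u hu
    have h1 := sum_solvent_mul_le hη ⟨hρ e, hρh e⟩ hm hb hz (hmem _) hu
    rw [hfin fun n y => solvent h (S n).episodeBudget *
      (((S n).mult - u) * (ρ' e - pay (S n).mult y))]
    refine le_of_eq_of_le (Finset.sum_congr rfl fun j hj => ?_) h1
    exact (hpay j (Finset.mem_range.1 hj) fun w => (m j - u) * (ρ' e - w)).symm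
  · intro δ hδ u hu
    have h1 := mul_sum_insolvent_le hη (hρ e) hh hm hb (hmem _) hb0
    rw [hfin fun n y => 1 - solvent h (S n).episodeBudget,
      hfin fun n y => solvent h (S n).episodeBudget *
        (η * h * (2 / δ ^ 2 * (((S n).mult - u) ^ 2 + (η * h) ^ 2)))]
    refine le_of_eq_of_le ?_ (h1.trans ?_)
    · congr 1
      exact Finset.sum_congr rfl fun j hj => by rw [hbS j (Finset.mem_range.1 hj)]
    · refine add_le_add le_rfl (div_le_div_of_nonneg_right
        (add_le_add le_rfl (Finset.sum_le_sum fun j hj => ?_)) hη.le)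
      rw [Finset.mem_range] at hj
      rw [hbS j hj]
      exact mul_le_mul_of_nonneg_left
        (overshoot_le hη.le hδ (hρ e) (hz j hj) (hmem _).2 hu) (solvent_mem _ _).1

end States

/-! ### Expectations over the campaign -/

/-! ### Product measures and conditioning by resampling one coordinate. -/

section Resample

variable {ι α : Type*} [Fintype ι] [MeasurableSpace α] {Q : ι → Measure α}
  [∀ i, IsProbabilityMeasure (Q i)]

/-- Resampling one coordinate preserves a product of probability measures. -/
theorem measurePreserving_update [DecidableEq ι] (t : ι) :
    MeasurePreserving (fun q : (ι → α) × α => Function.update q.1 t q.2)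
      ((Measure.pi Q).prod (Q t)) (Measure.pi Q) := by
  have hmeas : Measurable fun q : (ι → α) × α => Function.update q.1 t q.2 := by
    refine measurable_pi_iff.2 fun i => ?_
    by_cases hi : i = t
    · subst hi; simpa using measurable_snd
    · simp only [Function.update_of_ne hi]; fun_prop
  refine ⟨hmeas, (Measure.pi_eq fun s hs => ?_).symm⟩
  rw [Measure.map_apply hmeas (MeasurableSet.univ_pi hs)]
  have hset : (fun q : (ι → α) × α => Function.update q.1 t q.2) ⁻¹' univ.pi s =
      (univ.pi (Function.update s t univ)) ×ˢ s t := by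
    ext q
    simp only [mem_preimage, mem_pi, mem_univ, true_implies, mem_prod]
    constructor
    · intro hq
      refine ⟨fun i => ?_, by simpa using hq t⟩
      by_cases hi : i = t
      · subst hi; simp
      · simpa [Function.update_of_ne hi] using hq i
    · rintro ⟨h1, h2⟩ i
      by_cases hi : i = t
      · subst hi; simpa using h2
      · simpa [Function.update_of_ne hi] using h1 i
  rw [hset, Measure.prod_prod, Measure.pi_pi,
    ← Finset.mul_prod_erase Finset.univ (fun i => Q i (s i)) (Finset.mem_univ t),
    ← Finset.mul_prod_erase Finset.univ _ (Finset.mem_univ t), mul_comm]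
  congr 1
  simp only [Function.update_self, measure_univ, one_mul]
  refine Finset.prod_congr rfl fun i hi => ?_
  rw [Function.update_of_ne (Finset.ne_of_mem_erase hi)]

/-- The right side of `hfg` is the conditional expectation of `g` given the coordinates other than
`t`; Fubini replaces the tower property. -/
theorem integral_le_of_resample [DecidableEq ι] (t : ι) {f g : (ι → α) → ℝ} (hf : Integrable f (Measure.pi Q))
    (hg : Integrable g (Measure.pi Q))
    (hfg : ∀ x, f x ≤ ∫ y, g (Function.update x t y) ∂(Q t)) :
    ∫ x, f x ∂(Measure.pi Q) ≤ ∫ x, g x ∂(Measure.pi Q) := by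
  have hp := measurePreserving_update (Q := Q) t
  have hg' := hp.integrable_comp_of_integrable hg
  have h1 : ∫ x, g x ∂(Measure.pi Q) =
      ∫ x, ∫ y, g (Function.update x t y) ∂(Q t) ∂(Measure.pi Q) := by
    conv_lhs => rw [← hp.map_eq]
    rw [integral_map hp.measurable.aemeasurable (by rw [hp.map_eq]; exact hg.1)]
    exact integral_prod _ hg'
  rw [h1]
  exact integral_mono hf hg'.integral_prod_left hfg

theorem ae_pi_of_forall_ae {P : ι → α → Prop} (hP : ∀ i, ∀ᵐ y ∂(Q i), P i y) :
    ∀ᵐ x ∂(Measure.pi Q), ∀ i, P i (x i) :=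
  ae_all_iff.2 fun i => (measurePreserving_eval Q i).quasiMeasurePreserving.ae (hP i)

theorem integral_pi_eval (i : ι) {f : α → ℝ} (hf : Integrable f (Q i)) :
    ∫ x, f (x i) ∂(Measure.pi Q) = ∫ y, f y ∂(Q i) := by
  have hp := measurePreserving_eval Q i
  conv_rhs => rw [← hp.map_eq]
  rw [integral_map hp.measurable.aemeasurable (by rw [hp.map_eq]; exact hf.1)]

end Resample

theorem divNat_finProdFinEquiv {m n : ℕ} (e : Fin m) (j : Fin n) :
    (finProdFinEquiv (e, j)).divNat = e :=
  congrArg Prod.fst (finProdFinEquiv.symm_apply_apply (e, j))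

theorem sum_rounds_eq {m n : ℕ} (f : Fin (m * n) → ℝ) :
    ∑ t, f t = ∑ e : Fin m, ∑ j : Fin n, f (finProdFinEquiv (e, j)) := by
  rw [← Fintype.sum_prod_type' (f := fun e j => f (finProdFinEquiv (e, j)))]
  exact (finProdFinEquiv.sum_comp f).symm

/-! ### The hindsight benchmark and the campaign dual. -/

section Campaign

variable {E τ : ℕ} {h : ℝ} {F D : Fin E → Measure ℝ}

theorem IsEpisodicSetting.isProbabilityMeasure (hS : IsEpisodicSetting h F D) (e : Fin E) :
    IsProbabilityMeasure ((F e).prod (D e)) := by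
  have := hS.value_prob e
  have := hS.price_prob e
  infer_instance

theorem ae_campaign (hS : IsEpisodicSetting h F D) :
    ∀ᵐ x ∂(campaignLaw τ F D), ∀ t, IsRound h (x t) := by
  have := fun t : Fin (E * τ) => hS.isProbabilityMeasure t.divNat
  refine ae_pi_of_forall_ae fun t => ?_
  have := hS.value_prob t.divNat
  have := hS.price_prob t.divNat
  exact ae_isRound (hS.value_mem _) (hS.price_nonneg _)

theorem isProbabilityMeasure_campaignLaw (hS : IsEpisodicSetting h F D) :
    IsProbabilityMeasure (campaignLaw τ F D) := by
  have := fun t : Fin (E * τ) => hS.isProbabilityMeasure t.divNat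
  unfold campaignLaw
  infer_instance

theorem integrable_campaign_surplus (hS : IsEpisodicSetting h F D) {μ : ℝ} (hμ : -1 < μ)
    (t : Fin (E * τ)) :
    Integrable (fun x : Outcome (E * τ) => max ((x t).1 - (1 + μ) * (x t).2) 0)
      (campaignLaw τ F D) := by
  have := isProbabilityMeasure_campaignLaw (τ := τ) hS
  refine integrable_of_ae_mem_Icc (by fun_prop) (a := 0) (b := h) ?_
  filter_upwards [ae_campaign hS] with x hx using (hx t).surplus_mem hμ

theorem campaignDual_eq (hS : IsEpisodicSetting h F D) (B : ℝ) {μ : ℝ} (hμ : -1 < μ) :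
    campaignDual τ F D B μ = ∑ e, τ * roundDual (F e) (D e) μ + μ * B := by
  have := isProbabilityMeasure_campaignLaw (τ := τ) hS
  have hQ := fun t : Fin (E * τ) => hS.isProbabilityMeasure t.divNat
  have hint := integrable_campaign_surplus (τ := τ) hS hμ
  unfold campaignDual
  rw [integral_add (integrable_finsetSum _ fun t _ => hint t) (integrable_const _),
    integral_finsetSum _ fun t _ => hint t, sum_rounds_eq]
  simp only [integral_const, probReal_univ, one_smul, add_left_inj]
  refine Finset.sum_congr rfl fun e _ => ?_
  have h1 : ∀ j : Fin τ, ∫ x, max ((x (finProdFinEquiv (e, j))).1 -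
      (1 + μ) * (x (finProdFinEquiv (e, j))).2) 0 ∂(campaignLaw τ F D) =
      roundDual (F e) (D e) μ := by
    intro j
    have := hS.value_prob e
    have := hS.price_prob e
    have h2 := integral_pi_eval (Q := fun t : Fin (E * τ) => (F t.divNat).prod (D t.divNat))
      (finProdFinEquiv (e, j)) (f := fun y : ℝ × ℝ => max (y.1 - (1 + μ) * y.2) 0) (by
        rw [divNat_finProdFinEquiv]
        exact integrable_surplus (hS.value_mem e) (hS.price_nonneg e) hμ)
    rw [divNat_finProdFinEquiv] at h2
    exact h2
  simp [h1]

/-- Weak duality for the hindsight problem of one outcome. -/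
theorem hindsight_le {T : ℕ} {B μ : ℝ} (hB : 0 ≤ B) (hμ : 0 ≤ μ) (x : Outcome T) :
    hindsight B x ≤ (∑ t, max ((x t).1 - (1 + μ) * (x t).2) 0) + μ * B := by
  refine csSup_le ⟨_, 0, ⟨fun t => by simp, by simpa using hB⟩, rfl⟩ ?_
  rintro _ ⟨y, ⟨hy, hyB⟩, rfl⟩
  have h1 : ∀ t, ((x t).1 - (x t).2) * y t ≤
      max ((x t).1 - (1 + μ) * (x t).2) 0 + μ * ((x t).2 * y t) := by
    intro t
    have h2 : ((x t).1 - (1 + μ) * (x t).2) * y t ≤ max ((x t).1 - (1 + μ) * (x t).2) 0 * y t :=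
      mul_le_mul_of_nonneg_right (le_max_left _ _) (hy t).1
    have h3 : max ((x t).1 - (1 + μ) * (x t).2) 0 * y t ≤
        max ((x t).1 - (1 + μ) * (x t).2) 0 * 1 :=
      mul_le_mul_of_nonneg_left (hy t).2 (le_max_right _ _)
    linarith
  calc ∑ t, ((x t).1 - (x t).2) * y t
      ≤ ∑ t, (max ((x t).1 - (1 + μ) * (x t).2) 0 + μ * ((x t).2 * y t)) :=
        Finset.sum_le_sum fun t _ => h1 t
    _ = ∑ t, max ((x t).1 - (1 + μ) * (x t).2) 0 + μ * ∑ t, (x t).2 * y t := by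
        rw [Finset.sum_add_distrib, Finset.mul_sum]
    _ ≤ _ := add_le_add le_rfl (mul_le_mul_of_nonneg_left hyB hμ)

theorem integral_hindsight_le (hS : IsEpisodicSetting h F D) {B μ : ℝ} (hB : 0 ≤ B)
    (hμ : 0 ≤ μ) : ∫ x, hindsight B x ∂(campaignLaw τ F D) ≤ campaignDual τ F D B μ := by
  have := isProbabilityMeasure_campaignLaw (τ := τ) hS
  have hint : Integrable (fun x : Outcome (E * τ) =>
      (∑ t, max ((x t).1 - (1 + μ) * (x t).2) 0) + μ * B) (campaignLaw τ F D) :=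
    (integrable_finsetSum _ fun t _ =>
      integrable_campaign_surplus hS (by linarith) t).add (integrable_const _)
  -- Nonnegativity and an integrable upper bound suffice here, so measurability of `hindsight` is
  -- not needed.
  refine integral_mono_of_nonneg ?_ hint (.of_forall fun x => hindsight_le hB hμ x)
  filter_upwards [ae_campaign hS] with x hx
  refine le_csSup ⟨∑ t, max ((x t).1 - (1 + 0) * (x t).2) 0 + 0 * B, ?_⟩
    ⟨0, ⟨fun t => by simp, by simpa using hB⟩, by simp⟩
  rintro _ ⟨y, ⟨hy, hyB⟩, rfl⟩
  simp only [zero_mul, add_zero, one_mul]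
  refine Finset.sum_le_sum fun t _ => ?_
  calc ((x t).1 - (x t).2) * y t ≤ max ((x t).1 - (x t).2) 0 * y t :=
        mul_le_mul_of_nonneg_right (le_max_left _ _) (hy t).1
    _ ≤ _ := mul_le_of_le_one_right (le_max_right _ _) (hy t).2

/-- Stationarity of the campaign dual: the optimal rates fit the budget, and exhaust it unless
the optimal multiplier vanishes. -/
theorem campaign_stationarity (hS : IsEpisodicSetting h F D)
    (hd : ∀ e, ∀ μ, 0 ≤ μ → DifferentiableAt ℝ (roundDual (F e) (D e)) μ) {B μs : ℝ}
    (hμs : 0 ≤ μs) (hmin : IsMinOn (campaignDual τ F D B) (Ici 0) μs) {ν : ℝ} (hν : 0 ≤ ν) :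
    0 ≤ (B - τ * ∑ e, spend (F e) (D e) μs) * (ν - μs) := by
  have h1 : HasDerivAt (fun μ => ∑ e, τ * roundDual (F e) (D e) μ + μ * B)
      (∑ e, τ * (-spend (F e) (D e) μs) + 1 * B) μs := by
    refine HasDerivAt.add ?_ ((hasDerivAt_id μs).mul_const B)
    refine HasDerivAt.fun_sum fun e _ => ?_
    have := hS.value_prob e
    have := hS.price_prob e
    exact (hasDerivAt_roundDual (hS.value_mem e) (hS.price_nonneg e) hμs (hd e μs hμs)).const_mul _
  have h2 : HasDerivAt (campaignDual τ F D B) (∑ e, τ * (-spend (F e) (D e) μs) + 1 * B) μs := by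
    refine h1.congr_of_eventuallyEq ?_
    filter_upwards [lt_mem_nhds (show -1 < μs by linarith)] with μ hμ
    exact campaignDual_eq hS B hμ
  have h3 := deriv_mul_sub_nonneg_of_isMinOn hμs h2 hmin hν
  rw [Finset.mul_sum]
  simp only [mul_neg, Finset.sum_neg_distrib] at h3
  linarith

/-- The benchmark is bounded by the episode duals at the planned rates. -/
theorem mul_integral_hindsight_le (hS : IsEpisodicSetting h F D)
    (hd : ∀ e, ∀ μ, 0 ≤ μ → DifferentiableAt ℝ (roundDual (F e) (D e)) μ) {B μs ω : ℝ}
    (hB : 0 ≤ B) (hω : 0 ≤ ω) (hω1 : ω < 1)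
    (hμs : 0 ≤ μs) (hmin : IsMinOn (campaignDual τ F D B) (Ici 0) μs) {ρ' μ' : Fin E → ℝ}
    (hρ : ∀ e, (1 - ω) * spend (F e) (D e) μs ≤ ρ' e) (hμ' : ∀ e, 0 ≤ μ' e) :
    (1 - ω) * ∫ x, hindsight B x ∂(campaignLaw τ F D) ≤
      ∑ e, τ * (roundDual (F e) (D e) (μ' e) + μ' e * ρ' e) := by
  have h1 := integral_hindsight_le (τ := τ) hS hB hμs
  rw [campaignDual_eq hS B (by linarith)] at h1
  -- The test points `0` and `2 * μs` give both signs of `μs` times the slack, hence complementary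
  -- slackness.
  have h2 := campaign_stationarity hS hd hμs hmin le_rfl
  have h3 := campaign_stationarity hS hd hμs hmin (show 0 ≤ 2 * μs by linarith)
  have h4 : μs * B = ∑ e, τ * (μs * spend (F e) (D e) μs) := by
    have : μs * B = μs * (τ * ∑ e, spend (F e) (D e) μs) := by linarith
    rw [this, Finset.mul_sum, Finset.mul_sum]
    exact Finset.sum_congr rfl fun e _ => by ring
  rw [h4, ← Finset.sum_add_distrib] at h1
  refine (mul_le_mul_of_nonneg_left h1 (by linarith)).trans ?_
  rw [Finset.mul_sum]
  refine Finset.sum_le_sum fun e _ => ?_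
  have := hS.value_prob e
  have := hS.price_prob e
  have hsub : roundDual (F e) (D e) μs - spend (F e) (D e) μs * (μ' e - μs) ≤
      roundDual (F e) (D e) (μ' e) :=
    roundDual_sub_le (hS.value_mem e) (hS.price_nonneg e) hμs (by linarith [hμ' e])
  have h0 : 0 ≤ roundDual (F e) (D e) (μ' e) :=
    (roundDual_mem (hS.value_mem e) (hS.price_nonneg e) (by linarith [hμ' e])).1
  rw [← mul_add, mul_left_comm]
  refine mul_le_mul_of_nonneg_left ?_ (Nat.cast_nonneg _)
  have h5 : μ' e * ((1 - ω) * spend (F e) (D e) μs) ≤ μ' e * ρ' e :=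
    mul_le_mul_of_nonneg_left (hρ e) (hμ' e)
  have h6 : (1 - ω) * (roundDual (F e) (D e) μs + μs * spend (F e) (D e) μs) ≤
      (1 - ω) * (roundDual (F e) (D e) (μ' e) + μ' e * spend (F e) (D e) μs) :=
    mul_le_mul_of_nonneg_left (by linarith) (by linarith)
  have h7 := mul_nonneg hω h0
  linarith

end Campaign

/-! ### Loss of the algorithm in one episode -/

section Loss

variable {E τ : ℕ} {h B η U μ₁ : ℝ} {F D : Fin E → Measure ℝ} {ρ' : Fin E → ℝ}

/-- Conditioning on the state before a round, for functions of the state and of the round. -/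
theorem integral_state_le (hS : IsEpisodicSetting h F D) (hμ₁ : μ₁ ∈ Icc 0 U) (t : Fin (E * τ))
    {c : PacingState → ℝ} {φ : PacingState → ℝ × ℝ → ℝ}
    (hc : Integrable (fun x => c (pacingState τ B ρ' η U μ₁ x t)) (campaignLaw τ F D))
    (hφ : Integrable (fun x => φ (pacingState τ B ρ' η U μ₁ x t) (x t)) (campaignLaw τ F D))
    (hle : ∀ s : PacingState, s.mult ∈ Icc 0 U →
      c s ≤ ∫ y, φ s y ∂((F t.divNat).prod (D t.divNat))) :
    ∫ x, c (pacingState τ B ρ' η U μ₁ x t) ∂(campaignLaw τ F D) ≤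
      ∫ x, φ (pacingState τ B ρ' η U μ₁ x t) (x t) ∂(campaignLaw τ F D) := by
  have := fun t : Fin (E * τ) => hS.isProbabilityMeasure t.divNat
  refine integral_le_of_resample t hc hφ fun x => ?_
  simp only [pacingState_update x t _ le_rfl, Function.update_self]
  exact hle _ (mult_mem hμ₁ x t)

theorem measurable_solvent (h : ℝ) : Measurable (solvent h) :=
  (solvent_mono h).measurable

/-- Utility of the algorithm in round `t`. -/
noncomputable def utility (τ : ℕ) (B : ℝ) (ρ' : Fin E → ℝ) (η U μ₁ : ℝ) (t : Fin (E * τ))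
    (x : Outcome (E * τ)) : ℝ :=
  if (x t).2 < (pacingState τ B ρ' η U μ₁ x t).bid (x t).1 then (x t).1 - (x t).2 else 0

theorem integrable_utility (hS : IsEpisodicSetting h F D) (hμ₁ : μ₁ ∈ Icc 0 U)
    (t : Fin (E * τ)) : Integrable (utility τ B ρ' η U μ₁ t) (campaignLaw τ F D) := by
  have := isProbabilityMeasure_campaignLaw (τ := τ) hS
  obtain ⟨h1, h2, h3⟩ := measurable_pacingState (τ := τ) (B := B) (ρ' := ρ') (η := η) (U := U)
    (μ₁ := μ₁) t
  refine integrable_of_ae_mem_Icc (a := 0) (b := h) ?_ ?_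
  · unfold utility PacingState.bid
    exact Measurable.ite (measurableSet_lt (by fun_prop) (by fun_prop)) (by fun_prop)
      measurable_const
  · filter_upwards [ae_campaign hS] with x hx
    have hm := mult_mem (B := B) (ρ' := ρ') (η := η) hμ₁ x t
    obtain ⟨hv, hp⟩ := hx t
    have hb := bid_le hm.1 hv.1
    unfold utility
    split_ifs with hc
    · exact ⟨by linarith, by linarith [hv.2]⟩
    · exact ⟨le_rfl, hv.1.trans hv.2⟩

theorem alphaRegret_eq (hS : IsEpisodicSetting h F D) (hμ₁ : μ₁ ∈ Icc 0 U) (α : ℝ) :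
    alphaRegret τ F D B α (episodicAdaptivePacing τ B ρ' η U μ₁) =
      α * (∫ x, hindsight B x ∂(campaignLaw τ F D)) -
        ∑ e, ∑ j, ∫ x, utility τ B ρ' η U μ₁ (finProdFinEquiv (e, j)) x
          ∂(campaignLaw τ F D) := by
  unfold alphaRegret
  rw [← sum_rounds_eq fun t => ∫ x, utility τ B ρ' η U μ₁ t x ∂(campaignLaw τ F D),
    ← integral_finsetSum _ fun t _ => integrable_utility hS hμ₁ t]
  rfl

/-- The first term is the gradient descent regret against `0`. The second is `h` times a bound on
the expected number of insolvent rounds, since `V ≤ h`. -/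
theorem episode_loss (hS : IsEpisodicSetting h F D) (hτ : 0 < τ) (hη : 0 < η)
    (hμ₁ : μ₁ ∈ Icc 0 U) (hρ : ∀ e, 0 ≤ ρ' e) (hρh : ∀ e, ρ' e ≤ h) (hB : τ * ∑ e, ρ' e ≤ B)
    (e : Fin E) (hd : ∀ μ, 0 ≤ μ → DifferentiableAt ℝ (roundDual (F e) (D e)) μ)
    {lam δ : ℝ} (hlam : 0 < lam) (hδ : 0 < δ)
    (hmono : ∀ a ∈ Icc 0 U, ∀ b ∈ Icc 0 U, a ≤ b →
      lam * (b - a) ≤ spend (F e) (D e) a - spend (F e) (D e) b)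
    {u : ℝ} (hu : u ∈ Icc 0 (U - δ))
    (hopt : ∀ ν, 0 ≤ ν → 0 ≤ (ρ' e - spend (F e) (D e) u) * (ν - u)) :
    τ * (roundDual (F e) (D e) u + u * ρ' e) -
      ∑ j, ∫ x, utility τ B ρ' η U μ₁ (finProdFinEquiv (e, j)) x ∂(campaignLaw τ F D) ≤
    (U ^ 2 + τ * (η * h) ^ 2) / (2 * η) + h / (lam * δ) *
      (h + (U + η * h * (2 / δ ^ 2 * ((U ^ 2 + τ * (η * h) ^ 2) / (2 * η) / lam +
        τ * (η * h) ^ 2))) / η) := by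
  have := hS.value_prob e
  have := hS.price_prob e
  have hF := hS.value_mem e
  have hD := hS.price_nonneg e
  have hP := isProbabilityMeasure_campaignLaw (τ := τ) hS
  have hh : 0 ≤ h := (hρ e).trans (hρh e)
  have hU : 0 ≤ U := hμ₁.1.trans hμ₁.2
  have huU : u ∈ Icc 0 U := ⟨hu.1, by linarith [hu.2]⟩
  set P := campaignLaw τ F D with hPdef
  set G := spend (F e) (D e) with hG
  set r := ρ' e with hr
  set V := roundDual (F e) (D e) u + u * r with hV
  set W := (U ^ 2 + τ * (η * h) ^ 2) / (2 * η) with hW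
  let idx : Fin τ → Fin (E * τ) := fun j => finProdFinEquiv (e, j)
  let S : Outcome (E * τ) → Fin τ → PacingState := fun x j => pacingState τ B ρ' η U μ₁ x (idx j)
  have hmem : ∀ x j, (S x j).mult ∈ Icc 0 U := fun x j => mult_mem hμ₁ x _
  -- the value of the episode
  have hVle : ∀ m, 0 ≤ m → V ≤ roundDual (F e) (D e) m + m * r := by
    intro m hm
    have h1 := roundDual_sub_le hF hD hu.1 (show -1 < m by linarith)
    have h2 := hopt m hm
    linarith
  have hV0 : 0 ≤ V := add_nonneg (roundDual_mem hF hD (by linarith [hu.1])).1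
    (mul_nonneg hu.1 (hρ e))
  have hVh : V ≤ h := by
    have h1 := hVle 0 le_rfl
    have h2 := (roundDual_mem hF hD (show (-1 : ℝ) < 0 by norm_num)).2
    linarith
  -- `r ≥ G u ≥ G U + lam * (U - u)` with `G U ≥ 0`: the gap `δ` below the cap keeps the planned
  -- rate away from zero.
  have hrδ : lam * δ ≤ r := by
    have h1 := hopt (u + 1) (by linarith [hu.1])
    have h2 := hmono u huU U ⟨hU, le_rfl⟩ huU.2
    have h3 := (spend_mem hF hD hU).1
    have h4 : lam * δ ≤ lam * (U - u) := mul_le_mul_of_nonneg_left (by linarith [hu.2]) hlam.le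
    have h5 : G u ≤ r := by linarith
    have h6 : 0 ≤ G U := h3
    linarith
  -- Split `r - G m` into `r - G u`, whose product with `m - u` is nonnegative by optimality, and `G
  -- u - G m`, which is strongly monotone.
  have hdrift : ∀ m ∈ Icc 0 U, lam * (m - u) ^ 2 ≤ (m - u) * (r - G m) := by
    intro m hm
    have h1 := hopt m hm.1
    rcases le_total m u with hc | hc
    · nlinarith [mul_nonneg (sub_nonneg.2 hc) (sub_nonneg.2 (hmono m hm u huU hc))]
    · nlinarith [mul_nonneg (sub_nonneg.2 hc) (sub_nonneg.2 (hmono u huU m hm hc))]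
  -- measurability and integrability
  have hmeas : ∀ j, Measurable (fun x => (S x j).mult) ∧
      Measurable (fun x => solvent h (S x j).episodeBudget) := fun j =>
    ⟨(measurable_pacingState _).1, (measurable_solvent h).comp (measurable_pacingState _).2.1⟩
  have hpaym : ∀ j, Measurable fun x : Outcome (E * τ) => pay (S x j).mult (x (idx j)) := by
    intro j
    have := (hmeas j).1
    exact Measurable.ite (measurableSet_le (by fun_prop) (by fun_prop)) (by fun_prop)
      measurable_const
  have hgainm : ∀ j, Measurable fun x : Outcome (E * τ) => gain (S x j).mult (x (idx j)) := by
    intro j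
    have := (hmeas j).1
    exact Measurable.ite (measurableSet_lt (by fun_prop) (by fun_prop)) (by fun_prop)
      measurable_const
  have hround := ae_campaign (τ := τ) hS
  have hIa : ∀ j, Integrable (fun x => solvent h (S x j).episodeBudget) P := fun j =>
    integrable_of_ae_mem_Icc (hmeas j).2 (.of_forall fun x => solvent_mem h _)
  have hImul : ∀ j, ∀ {f : Outcome (E * τ) → ℝ}, Integrable f P →
      Integrable (fun x => solvent h (S x j).episodeBudget * f x) P := fun j f hf =>
    hf.bdd_mul (hmeas j).2.aestronglyMeasurable (c := 1) (.of_forall fun x => by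
      have := solvent_mem h (S x j).episodeBudget
      rw [Real.norm_eq_abs, abs_of_nonneg this.1]; exact this.2)
  have hIpay : ∀ j, Integrable (fun x => r - pay (S x j).mult (x (idx j))) P := fun j =>
    (integrable_const _).sub (integrable_of_ae_mem_Icc (hpaym j) (hround.mono fun x hx =>
      (hx _).pay_mem (hmem x j).1))
  have hIgain : ∀ j, Integrable (fun x => gain (S x j).mult (x (idx j))) P := fun j =>
    integrable_of_ae_mem_Icc (hgainm j) (hround.mono fun x hx => (hx _).gain_mem (hmem x j).1)
  have hIshift : ∀ j, ∀ w ∈ Icc 0 U,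
      Integrable (fun x => ((S x j).mult - w) * (r - pay (S x j).mult (x (idx j)))) P := by
    intro j w hw
    have := (hmeas j).1
    refine (hIpay j).bdd_mul (c := U) (this.sub_const w).aestronglyMeasurable (.of_forall fun x => ?_)
    have h1 := hmem x j
    rw [Real.norm_eq_abs, abs_le]
    constructor <;> linarith [h1.1, h1.2, hw.1, hw.2]
  have hIsq : ∀ j, Integrable (fun x => ((S x j).mult - u) ^ 2) P := by
    intro j
    have := (hmeas j).1
    refine integrable_of_ae_mem_Icc (a := 0) (b := U ^ 2) (by fun_prop) (.of_forall fun x => ?_)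
    have h1 := hmem x j
    exact ⟨sq_nonneg _, by apply sq_le_sq' <;> linarith [h1.1, h1.2, huU.1, huU.2]⟩
  have hIdual : ∀ j, Integrable (fun x => solvent h (S x j).episodeBudget *
      (gain (S x j).mult (x (idx j)) +
        ((S x j).mult - 0) * (r - pay (S x j).mult (x (idx j))))) P := fun j =>
    hImul j ((hIgain j).add (hIshift j 0 ⟨le_rfl, hU⟩))
  -- conditional expectations of one round
  have hdiv : ∀ j, (idx j).divNat = e := fun j => divNat_finProdFinEquiv e j
  -- Mean utility is `R(m) + m * G m`; adding `m * (r - G m)` cancels the spend and leaves the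
  -- episode dual at `m`, which is at least `V`.
  have hgainE : ∀ j, V * ∫ x, solvent h (S x j).episodeBudget ∂P ≤
      ∫ x, solvent h (S x j).episodeBudget * (gain (S x j).mult (x (idx j)) +
        ((S x j).mult - 0) * (r - pay (S x j).mult (x (idx j)))) ∂P := by
    intro j
    rw [← integral_const_mul]
    refine integral_state_le hS hμ₁ (idx j) (c := fun s => V * solvent h s.episodeBudget)
      (φ := fun s y => solvent h s.episodeBudget * (gain s.mult y +
        (s.mult - 0) * (r - pay s.mult y))) ((hIa j).const_mul V)
      (hIdual j) fun s hs => ?_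
    have hp := integrable_pay hF hD hs.1
    have hp2 : Integrable (fun y => (s.mult - 0) * (r - pay s.mult y)) ((F e).prod (D e)) :=
      ((integrable_const _).sub hp).const_mul _
    rw [hdiv, integral_const_mul, integral_add (integrable_gain hF hD hs.1) hp2,
      integral_const_mul,
      integral_sub (integrable_const _) hp, integral_gain hF hD hs.1 (hd _ hs.1), mul_comm V]
    refine mul_le_mul_of_nonneg_left ?_ (solvent_mem _ _).1
    have h1 := hVle s.mult hs.1
    have h2 : ∫ y, pay s.mult y ∂((F e).prod (D e)) = G s.mult := rfl
    rw [h2]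
    simp only [integral_const, probReal_univ, one_smul]
    change V ≤ roundDual (F e) (D e) s.mult + s.mult * G s.mult + _
    linarith
  have hdriftE : ∀ j, lam * ∫ x, solvent h (S x j).episodeBudget * ((S x j).mult - u) ^ 2 ∂P ≤
      ∫ x, solvent h (S x j).episodeBudget *
        (((S x j).mult - u) * (r - pay (S x j).mult (x (idx j)))) ∂P := by
    intro j
    rw [← integral_const_mul]
    refine integral_state_le hS hμ₁ (idx j)
      (c := fun s => lam * (solvent h s.episodeBudget * (s.mult - u) ^ 2))
      (φ := fun s y => solvent h s.episodeBudget * ((s.mult - u) * (r - pay s.mult y)))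
      ((hImul j (hIsq j)).const_mul lam) (hImul j (hIshift j u huU)) fun s hs => ?_
    have hp := integrable_pay hF hD hs.1
    rw [hdiv, integral_const_mul, integral_const_mul, integral_sub (integrable_const _) hp,
      mul_left_comm]
    refine mul_le_mul_of_nonneg_left ?_ (solvent_mem _ _).1
    simp only [integral_const, probReal_univ, one_smul]
    exact hdrift s.mult hs
  -- path estimates in expectation
  have hpath := hround.mono fun x hx => episode_path (B := B) hρ hx hτ hη hμ₁ hρh hB e
  have hgainW : ∑ j, ∫ x, solvent h (S x j).episodeBudget * (gain (S x j).mult (x (idx j)) +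
        ((S x j).mult - 0) * (r - pay (S x j).mult (x (idx j)))) ∂P ≤
      ∑ j, ∫ x, utility τ B ρ' η U μ₁ (idx j) x ∂P + W := by
    rw [← integral_finsetSum _ fun j _ => hIdual j,
      ← integral_finsetSum _ fun j _ => integrable_utility hS hμ₁ (idx j)]
    have hWint : W = ∫ _ : Outcome (E * τ), W ∂P := by simp
    rw [hWint, ← integral_add (integrable_finsetSum _ fun j _ =>
      integrable_utility hS hμ₁ (idx j)) (integrable_const _)]
    refine integral_mono_ae (integrable_finsetSum _ fun j _ => hIdual j)
      ((integrable_finsetSum _ fun j _ =>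
      integrable_utility hS hμ₁ (idx j)).add (integrable_const _)) ?_
    filter_upwards [hround, hpath] with x hx hpx
    simp only [mul_add, Finset.sum_add_distrib]
    refine add_le_add (Finset.sum_le_sum fun j _ => ?_) (hpx.1 0 ⟨le_rfl, hU⟩)
    exact solvent_mul_gain_le (hmem x j).1 (hx _) (episodeBudget_le_budget hρ hB (idx j).2.le)
  have hdriftW : ∑ j, ∫ x, solvent h (S x j).episodeBudget *
      (((S x j).mult - u) * (r - pay (S x j).mult (x (idx j)))) ∂P ≤ W := by
    rw [← integral_finsetSum _ fun j _ => hImul j (hIshift j u huU)]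
    have hWint : W = ∫ _ : Outcome (E * τ), W ∂P := by simp
    rw [hWint]
    refine integral_mono_ae (integrable_finsetSum _ fun j _ => hImul j (hIshift j u huU))
      (integrable_const _) ?_
    filter_upwards [hpath] with x hpx using hpx.1 u huU
  have hsq : ∑ j, ∫ x, solvent h (S x j).episodeBudget * ((S x j).mult - u) ^ 2 ∂P ≤
      W / lam := by
    rw [le_div_iff₀ hlam, mul_comm, Finset.mul_sum]
    exact (Finset.sum_le_sum fun j _ => hdriftE j).trans hdriftW
  set κ := η * h * (2 / δ ^ 2) with hκ
  have hκ0 : 0 ≤ κ := by positivity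
  have hIover : ∀ j, Integrable (fun x => solvent h (S x j).episodeBudget *
      (η * h * (2 / δ ^ 2 * (((S x j).mult - u) ^ 2 + (η * h) ^ 2)))) P := fun j =>
    hImul j ((((hIsq j).add (integrable_const _)).const_mul _).const_mul _)
  have hdead : r * ∑ j, (1 - ∫ x, solvent h (S x j).episodeBudget ∂P) ≤
      h + (U + κ * (W / lam + τ * (η * h) ^ 2)) / η := by
    have h1 : r * ∑ j, (1 - ∫ x, solvent h (S x j).episodeBudget ∂P) ≤
        h + (U + ∑ j, ∫ x, solvent h (S x j).episodeBudget *
          (η * h * (2 / δ ^ 2 * (((S x j).mult - u) ^ 2 + (η * h) ^ 2))) ∂P) / η := by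
      have hI1 : ∀ j, Integrable (fun x => 1 - solvent h (S x j).episodeBudget) P := fun j =>
        (integrable_const _).sub (hIa j)
      have hl : r * ∑ j, (1 - ∫ x, solvent h (S x j).episodeBudget ∂P) =
          ∫ x, r * ∑ j, (1 - solvent h (S x j).episodeBudget) ∂P := by
        rw [integral_const_mul, integral_finsetSum _ fun j _ => hI1 j]
        congr 1
        refine Finset.sum_congr rfl fun j _ => ?_
        rw [integral_sub (integrable_const _) (hIa j)]
        simp
      have hIsum := integrable_finsetSum Finset.univ fun j _ => hIover j
      have hI2 : Integrable (fun x => (U + ∑ j, solvent h (S x j).episodeBudget *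
          (η * h * (2 / δ ^ 2 * (((S x j).mult - u) ^ 2 + (η * h) ^ 2)))) / η) P :=
        ((integrable_const U).add hIsum).div_const η
      have hr' : h + (U + ∑ j, ∫ x, solvent h (S x j).episodeBudget *
          (η * h * (2 / δ ^ 2 * (((S x j).mult - u) ^ 2 + (η * h) ^ 2))) ∂P) / η =
          ∫ x, (h + (U + ∑ j, solvent h (S x j).episodeBudget *
          (η * h * (2 / δ ^ 2 * (((S x j).mult - u) ^ 2 + (η * h) ^ 2)))) / η) ∂P := by
        rw [integral_add (integrable_const _) hI2, integral_div,
          integral_add (integrable_const _) hIsum, integral_finsetSum _ fun j _ => hIover j]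
        simp
      rw [hl, hr']
      refine integral_mono_ae ((integrable_finsetSum _ fun j _ => hI1 j).const_mul r)
        ((integrable_const _).add hI2) ?_
      filter_upwards [hpath] with x hpx using hpx.2 δ hδ u hu.2
    refine h1.trans (add_le_add le_rfl (div_le_div_of_nonneg_right (add_le_add le_rfl ?_) hη.le))
    have h2 : ∀ j, ∫ x, solvent h (S x j).episodeBudget *
        (η * h * (2 / δ ^ 2 * (((S x j).mult - u) ^ 2 + (η * h) ^ 2))) ∂P ≤
        κ * (∫ x, solvent h (S x j).episodeBudget * ((S x j).mult - u) ^ 2 ∂P +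
          (η * h) ^ 2) := by
      intro j
      have h3 : (η * h) ^ 2 = ∫ _ : Outcome (E * τ), (η * h) ^ 2 ∂P := by simp
      conv_rhs => rw [h3]
      rw [← integral_add (hImul j (hIsq j)) (integrable_const _), ← integral_const_mul]
      refine integral_mono (hIover j)
        (((hImul j (hIsq j)).add (integrable_const _)).const_mul κ) fun x => ?_
      have h4 : solvent h (S x j).episodeBudget * (η * h) ^ 2 ≤ 1 * (η * h) ^ 2 :=
        mul_le_mul_of_nonneg_right (solvent_mem _ _).2 (sq_nonneg _)
      calc _ = κ * (solvent h (S x j).episodeBudget * ((S x j).mult - u) ^ 2 +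
            solvent h (S x j).episodeBudget * (η * h) ^ 2) := by rw [hκ]; ring
        _ ≤ κ * (solvent h (S x j).episodeBudget * ((S x j).mult - u) ^ 2 + (η * h) ^ 2) :=
            mul_le_mul_of_nonneg_left (by linarith) hκ0
    refine (Finset.sum_le_sum fun j _ => h2 j).trans ?_
    rw [← Finset.mul_sum, Finset.sum_add_distrib]
    refine mul_le_mul_of_nonneg_left (add_le_add hsq (le_of_eq ?_)) hκ0
    simp
  -- conclusion
  have hN0 : 0 ≤ ∑ j, (1 - ∫ x, solvent h (S x j).episodeBudget ∂P) := by
    refine Finset.sum_nonneg fun j _ => sub_nonneg.2 ?_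
    have := integral_mono (hIa j) (integrable_const (1 : ℝ)) fun x => (solvent_mem h _).2
    simpa using this
  set N := ∑ j, (1 - ∫ x, solvent h (S x j).episodeBudget ∂P) with hN
  have hNsum : V * N = V * τ - ∑ j, V * ∫ x, solvent h (S x j).episodeBudget ∂P := by
    rw [hN, Finset.sum_sub_distrib, mul_sub, Finset.mul_sum Finset.univ (fun j => ∫ x, _ ∂P)]
    simp
  have hlo := (Finset.sum_le_sum fun j (_ : j ∈ Finset.univ) => hgainE j).trans hgainW
  have hNle : N ≤ (h + (U + κ * (W / lam + τ * (η * h) ^ 2)) / η) / (lam * δ) := by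
    rw [le_div_iff₀ (by positivity), mul_comm]
    exact (mul_le_mul_of_nonneg_right hrδ hN0).trans hdead
  have hVN : V * N ≤ h * ((h + (U + κ * (W / lam + τ * (η * h) ^ 2)) / η) / (lam * δ)) :=
    mul_le_mul hVh hNle hN0 hh
  have hend : h / (lam * δ) * (h + (U + η * h * (2 / δ ^ 2 * (W / lam +
        τ * (η * h) ^ 2))) / η) =
      h * ((h + (U + κ * (W / lam + τ * (η * h) ^ 2)) / η) / (lam * δ)) := by
    rw [hκ]; ring
  rw [hend]
  change _ - ∑ j, ∫ x, utility τ B ρ' η U μ₁ (idx j) x ∂P ≤ _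
  linarith

/-- The loss of an episode is of order `√τ` when the step size is of order `1 / √τ`. -/
theorem loss_le_sqrt {lam δ c₁ c₂ : ℝ} (hτ : 0 < τ) (hh : 0 ≤ h) (hU : 0 ≤ U) (hlam : 0 < lam)
    (hδ : 0 < δ) (hc₁ : 0 < c₁) (h1 : c₁ / √(τ : ℝ) ≤ η) (h2 : η ≤ c₂ / √(τ : ℝ)) :
    (U ^ 2 + τ * (η * h) ^ 2) / (2 * η) + h / (lam * δ) *
      (h + (U + η * h * (2 / δ ^ 2 * ((U ^ 2 + τ * (η * h) ^ 2) / (2 * η) / lam +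
        τ * (η * h) ^ 2))) / η) ≤
    ((U ^ 2 / c₁ + c₂ * h ^ 2) / 2 + h / (lam * δ) * (h + U / c₁ + h * (2 / δ ^ 2 *
      ((U ^ 2 / c₁ + c₂ * h ^ 2) / 2 / lam + c₂ ^ 2 * h ^ 2)))) * √(τ : ℝ) := by
  set s := √(τ : ℝ) with hs
  have hτ1 : (1 : ℝ) ≤ τ := by exact_mod_cast hτ
  have hs1 : 1 ≤ s := Real.one_le_sqrt.2 hτ1
  have hss : s * s = τ := Real.mul_self_sqrt (by positivity)
  have hs0 : 0 < s := by linarith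
  have hη : 0 < η := lt_of_lt_of_le (by positivity) h1
  rw [div_le_iff₀ hs0] at h1
  rw [le_div_iff₀ hs0] at h2
  -- The loss is increasing in `1 / η`, `τ * η` and `τ * η ^ 2`, so bounds on these three suffice.
  have hinv : 1 / η ≤ s / c₁ := by
    rw [div_le_div_iff₀ hη hc₁]; linarith
  have hηs : τ * η ^ 2 ≤ c₂ ^ 2 := by
    rw [← hss]
    have : (η * s) ^ 2 ≤ c₂ ^ 2 := pow_le_pow_left₀ (by positivity) h2 2
    linarith
  have hηs' : τ * η ≤ c₂ * s := by
    rw [← hss]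
    have := mul_le_mul_of_nonneg_right h2 hs0.le
    linarith
  set w := (U ^ 2 / c₁ + c₂ * h ^ 2) / 2 with hw
  have hW : (U ^ 2 + τ * (η * h) ^ 2) / (2 * η) ≤ w * s := by
    have e1 : (U ^ 2 + τ * (η * h) ^ 2) / (2 * η) =
        (U ^ 2 * (1 / η) + h ^ 2 * (τ * η)) / 2 := by
      field_simp
    have e2 : w * s = (U ^ 2 * (s / c₁) + h ^ 2 * (c₂ * s)) / 2 := by rw [hw]; ring
    rw [e1, e2]
    gcongr
  set W := (U ^ 2 + τ * (η * h) ^ 2) / (2 * η) with hWdef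
  have hV : τ * (η * h) ^ 2 ≤ c₂ ^ 2 * h ^ 2 * s := by
    have : τ * (η * h) ^ 2 ≤ c₂ ^ 2 * h ^ 2 := by
      have := mul_le_mul_of_nonneg_right hηs (sq_nonneg h)
      linarith
    exact this.trans (le_mul_of_one_le_right (by positivity) hs1)
  have e3 : (U + η * h * (2 / δ ^ 2 * (W / lam + τ * (η * h) ^ 2))) / η =
      U * (1 / η) + h * (2 / δ ^ 2 * (W / lam + τ * (η * h) ^ 2)) := by
    field_simp
  have e4 : (w + h / (lam * δ) * (h + U / c₁ + h * (2 / δ ^ 2 *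
      (w / lam + c₂ ^ 2 * h ^ 2)))) * s = w * s + h / (lam * δ) * (h * s + (U * (s / c₁) +
        h * (2 / δ ^ 2 * (w * s / lam + c₂ ^ 2 * h ^ 2 * s)))) := by ring
  rw [e3, e4]
  have hhs : h ≤ h * s := le_mul_of_one_le_right hh hs1
  gcongr

end Loss

end EpisodicPacing

/-! ### Assembly of the regret bound. -/

theorem mainTheorem4 (h lam M mubar δ c₁ c₂ : ℝ) (hh : 0 < h) (hlam : 0 < lam) (hδ : 0 < δ)
    (hc₁ : 0 < c₁) :
    ∃ (C : ℝ) (k : ℕ), ∀ (E τ : ℕ), 0 < E → 0 < τ →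
      ∀ (F D : Fin E → MeasureTheory.Measure ℝ), EpisodicPacing.IsEpisodicSetting h F D →
      EpisodicPacing.Admissible τ F D lam M mubar →
      ∀ (B : ℝ), 0 < B →
      ∀ (ρ ρ' : Fin E → ℝ) (ω : ℝ), 0 ≤ ω → ω < 1 →
      EpisodicPacing.IsOptimalSpendRates τ F D B ρ →
      (∀ e, ρ' e ≤ ρ e ∧ (1 - ω) * ρ e ≤ ρ' e) →
      -- the cap on the multiplier exceeds a minimizer of each episode's dual by at least `δ`
      (∀ e, ∃ μ' ∈ Set.Icc 0 (mubar - δ),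
        IsMinOn (EpisodicPacing.episodeDual τ (F e) (D e) (τ * ρ' e)) (Set.Ici 0) μ') →
      ∀ (η : ℝ), c₁ / √(τ : ℝ) ≤ η → η ≤ c₂ / √(τ : ℝ) →
      ∀ μ₁ ∈ Set.Icc 0 mubar,
        EpisodicPacing.alphaRegret τ F D B (1 - ω)
            (EpisodicPacing.episodicAdaptivePacing τ B ρ' η mubar μ₁)
          ≤ C * √((E : ℝ) * ((E * τ : ℕ) : ℝ)) *
              (1 + Real.log ((E : ℝ) * ((E * τ : ℕ) : ℝ))) ^ k := by
  -- The coefficient of `√τ` in `loss_le_sqrt` with `U = mubar`. No logarithm arises, so `k = 0`.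
  refine ⟨(mubar ^ 2 / c₁ + c₂ * h ^ 2) / 2 + h / (lam * δ) * (h + mubar / c₁ + h *
    (2 / δ ^ 2 * ((mubar ^ 2 / c₁ + c₂ * h ^ 2) / 2 / lam + c₂ ^ 2 * h ^ 2))), 0, ?_⟩
  intro E τ hE hτ F D hS hA B hB ρ ρ' ω hω hω1 hopt hplan hmin η hη1 hη2 μ₁ hμ₁
  obtain ⟨μs, hμs, hmins, hρ⟩ := hopt
  choose μ' hμ' hminE using hmin
  have hd : ∀ e, ∀ μ, 0 ≤ μ →
      DifferentiableAt ℝ (EpisodicPacing.roundDual (F e) (D e)) μ := by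
    intro e μ hμ
    have := hS.value_prob e
    have := hS.price_prob e
    refine EpisodicPacing.differentiableAt_roundDual (hS.value_mem e) (hS.price_nonneg e) hτ hμ ?_
    simpa using hA.differentiable e 0 0 (by norm_num) μ hμ
  have hτ0 : (0 : ℝ) < τ := by exact_mod_cast hτ
  have hη : 0 < η := lt_of_lt_of_le (div_pos hc₁ (Real.sqrt_pos.2 hτ0)) hη1
  have hU : 0 ≤ mubar := hμ₁.1.trans hμ₁.2
  have hderiv : ∀ e (Be μ : ℝ), 0 ≤ μ → HasDerivAt
      (EpisodicPacing.episodeDual τ (F e) (D e) Be)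
      (τ * (-EpisodicPacing.spend (F e) (D e) μ) + 1 * Be) μ := by
    intro e Be μ hμ
    have := hS.value_prob e
    have := hS.price_prob e
    have h1 := ((EpisodicPacing.hasDerivAt_roundDual (hS.value_mem e) (hS.price_nonneg e) hμ
      (hd e μ hμ)).const_mul (τ : ℝ)).add ((hasDerivAt_id μ).mul_const Be)
    refine h1.congr_of_eventuallyEq ?_
    filter_upwards [lt_mem_nhds (show -1 < μ by linarith)] with ν hν
    exact EpisodicPacing.episodeDual_eq (hS.value_mem e) (hS.price_nonneg e) τ Be hν
  have hspend : ∀ e μ, 0 ≤ μ → EpisodicPacing.spend (F e) (D e) μ ∈ Icc 0 h := by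
    intro e μ hμ
    have := hS.value_prob e
    have := hS.price_prob e
    exact EpisodicPacing.spend_mem (hS.value_mem e) (hS.price_nonneg e) hμ
  have hρ0 : ∀ e, 0 ≤ ρ' e := fun e =>
    (mul_nonneg (by linarith) (hρ e ▸ (hspend e μs hμs).1)).trans (hplan e).2
  have hρh : ∀ e, ρ' e ≤ h := fun e => (hplan e).1.trans (hρ e ▸ (hspend e μs hμs).2)
  have hbudget : τ * ∑ e, ρ' e ≤ B := by
    -- A test point above `μs` shows that the optimal rates, hence the smaller planned ones, fit the
    -- budget.
    have h1 := EpisodicPacing.campaign_stationarity hS hd hμs hmins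
      (show 0 ≤ μs + 1 by linarith)
    have h2 : (τ : ℝ) * ∑ e, ρ' e ≤ τ * ∑ e, EpisodicPacing.spend (F e) (D e) μs :=
      mul_le_mul_of_nonneg_left (Finset.sum_le_sum fun e _ => hρ e ▸ (hplan e).1) hτ0.le
    linarith
  have hmono : ∀ e, ∀ a ∈ Icc 0 mubar, ∀ b ∈ Icc 0 mubar, a ≤ b →
      lam * (b - a) ≤ EpisodicPacing.spend (F e) (D e) a - EpisodicPacing.spend (F e) (D e) b := by
    intro e a ha b hb hab
    have h1 := EpisodicPacing.mul_sub_le_deriv_sub_of_strongConvexOn (hA.strongConvex e 0)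
      (fun μ hμ => hderiv e 0 μ hμ.1) ha hb hab
    refine le_of_mul_le_mul_left ?_ hτ0
    linarith
  have hstat : ∀ e ν, 0 ≤ ν →
      0 ≤ (ρ' e - EpisodicPacing.spend (F e) (D e) (μ' e)) * (ν - μ' e) := by
    intro e ν hν
    have h1 := EpisodicPacing.deriv_mul_sub_nonneg_of_isMinOn (hμ' e).1
      (hderiv e (τ * ρ' e) _ (hμ' e).1) (hminE e) hν
    refine le_of_mul_le_mul_left ?_ hτ0
    linarith
  have hbench := EpisodicPacing.mul_integral_hindsight_le hS hd hB.le hω hω1 hμs hmins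
    (fun e => hρ e ▸ (hplan e).2) fun e => (hμ' e).1
  rw [EpisodicPacing.alphaRegret_eq hS hμ₁, pow_zero, mul_one]
  refine (sub_le_sub_right hbench _).trans ?_
  rw [← Finset.sum_sub_distrib]
  refine (Finset.sum_le_sum fun e _ => (EpisodicPacing.episode_loss hS hτ hη hμ₁ hρ0 hρh hbudget e
    (hd e) hlam hδ (hmono e) (hμ' e) (hstat e)).trans
    (EpisodicPacing.loss_le_sqrt hτ hh.le hU hlam hδ hc₁ hη1 hη2)).trans (le_of_eq ?_)
  have hsqrt : √((E : ℝ) * ((E * τ : ℕ) : ℝ)) = E * √(τ : ℝ) := by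
    rw [Nat.cast_mul, ← mul_assoc, Real.sqrt_mul (by positivity),
      Real.sqrt_mul_self (Nat.cast_nonneg _)]
  rw [hsqrt, Finset.sum_const, Finset.card_univ, Fintype.card_fin, nsmul_eq_mul]
  ring
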